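/- **Setting.** Let $q\in\mathbb C^\times$ not be a root of unity, and let $\alpha\in\mathbb C$ be such that $q^{2(\alpha+m)}\neq1$ for all $m\in\mathbb Z$. Logarithms of $q$ and of the spectral parameter $\zeta$ are fixed, so that $q^\alpha$, $\zeta^\alpha$ are defined and $(q^{\pm1}\zeta)^\alpha=q^{\pm\alpha}\zeta^\alpha$. Let $[k,l]$ be a chain segment with $n=l-k+1$ sites, $\mathcal H=(\mathbb C^2)^{\otimes n}$, $S=\frac12\sum_j\sigma^z_j$, $\mathbb S=[S,\cdot\,]$. An operator $X\in\operatorname{End}\mathcal H$ has spin $s\in\mathbb Z$ if $\mathbb SX=sX$. Let $R(\zeta)$ be the six-vertex matrix, which in the basis $++,+-,-+,--$ has the diagonal $1,\beta,\beta,1$ and the off-diagonal entries $\gamma$ in the middle block, with $\beta=\frac{(1-\zeta^2)q}{1-q^2\zeta^2}$, $\gamma=\frac{(1-q^2)\zeta}{1-q^2\zeta^2}$. Put $L_{a,j}(\zeta)=R_{a,j}(\zeta)$ with $V_a=\mathbb C^2$, and $$L_{A,j}(\zeta)=\begin{pmatrix}1-\zeta^2q^{2D+2}&-\zeta\mathbf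 a\\-\zeta\mathbf a^*&1\end{pmatrix}_j\begin{pmatrix}q^{-D}&0\\0&q^{D}\end{pmatrix}_j ,$$ where the $q$-oscillators act on $W^+=\bigoplus_{k\ge0}\mathbb C|k\rangle$ by $q^D|k\rangle=q^k|k\rangle$, $\mathbf a|k\rangle=(1-q^{2k})|k-1\rangle$, $\mathbf a^*|k\rangle=|k+1\rangle$ (scalar normalisations of the $L$-matrices play no role). Let $\mathbb L(Z)=LZL^{-1}$, $\mathbb T_a(\zeta,\alpha)Z=\mathbb L_{a,l}\cdots\mathbb L_{a,k}\,(q^{\alpha\sigma^z_a}Z)$, $\mathbb T_A(\zeta,\alpha)Z=\mathbb L_{A,l}\cdots\mathbb L_{A,k}\,(q^{2\alpha D_A}Z)$, and $$\mathbf k(\zeta,\alpha)X=\operatorname{tr}_{A,a}\bigl\{\sigma_a^+\,\mathbb T_a(\zeta,\alpha)\mathbb T_A(\zeta,\alpha)\,\zeta^{\alpha-\mathbb S}\bigl(\mathrm{id}_{A,a}\otimes q^{-2S}X\bigr)\bigr\},$$ where $\operatorname{tr}_A$ is the trace over $W^+$, continued by $\operatorname{tr}_A q^{2\alpha D}q^{mD}=(1-q^{2\alpha+m})^{-1}$.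 For $X$ of spin $s$ put $\mathbf k_{\rm skal}(\zeta,\alpha)X=\zeta^{-\alpha-s-1}\mathbf k(\zeta,\alpha)X$. With $\psi(\zeta,\alpha)=\frac{\zeta^\alpha(\zeta^2+1)}{2(\zeta^2-1)}$ and a small circle $\Gamma$ around $\xi^2=1$ (with $0,\zeta^2,q^{\pm2},q^{\pm4}$ outside of it), define on $X$ of spin $s$ $$\bar{\mathbf c}(\zeta,\alpha)X=\oint_\Gamma\frac{d\xi^2}{2\pi i\,\xi^2}\,\psi(\zeta/\xi,\alpha+s+1)\,\mathbf k(\xi,\alpha)X,$$ $$\mathbf c(\zeta,\alpha)X=\oint_\Gamma\frac{d\xi^2}{4\pi i\,\xi^2}\,\psi(\zeta/\xi,\alpha+s+1)\bigl(\mathbf k(q\xi,\alpha)+\mathbf k(q^{-1}\xi,\alpha)\bigr)X,$$ $$\mathbf f^{\rm sing}(\zeta,\alpha)X=\oint_\Gamma\frac{d\xi^2}{4\pi i\,\xi^2}\,\psi(\zeta/\xi,\alpha+s+1)\bigl(-\mathbf k(q\xi,\alpha)+\mathbf k(q^{-1}\xi,\alpha)\bigr)X,$$ and $\mathbf f=\mathbf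 f^{\rm sing}+\mathbf f^{\rm reg}$, where $\mathbf f^{\rm reg}(\zeta,\alpha)X$ is $\zeta^{\alpha+s+1}$ times a Laurent polynomial in $\zeta^2$ such that $$\mathbf k(\zeta,\alpha)X=\bigl(\bar{\mathbf c}(\zeta,\alpha)+\mathbf c(q\zeta,\alpha)+\mathbf c(q^{-1}\zeta,\alpha)+\mathbf f(q\zeta,\alpha)-\mathbf f(q^{-1}\zeta,\alpha)\bigr)X .$$ **Lemma.** Let $s\in\mathbb Z$. On operators $X$ of spin $s$, $\mathbf k_{\rm skal}$ has a partial fraction decomposition, with linear operators $\rho^{(\varepsilon)}_j(\alpha)$, $\kappa_j(\alpha)$ on $\operatorname{End}\mathcal H$ that do not depend on $\zeta$, $$\mathbf k_{\rm skal}(\zeta,\alpha)X=\Bigl[\sum_{j=1}^n\sum_{\varepsilon=-1}^1\frac{\rho^{(\varepsilon)}_j(\alpha)}{(\zeta^2-q^{2\varepsilon})^j}+\sum_{j=1}^s\frac{\kappa_j(\alpha)}{\zeta^{2j}}\Bigr]X\qquad(\zeta^2\neq1,q^{\pm2}).$$ For any such $\rho_j^{(\varepsilon)}$ (where $\rho_j^{(\pm)}=\rho_j^{(\pm1)}$),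 $\kappa_j$ and any $X$ of spin $s$, the function $\mathbf f^{\rm reg}(\zeta,\alpha)X$ exists and is unique, and (for $\zeta^2\ne1$) $$\bar{\mathbf c}(\zeta,\alpha)X=\zeta^{\alpha+s+1}\sum_{j=0}^n\frac{\bar c_j(\alpha)}{(\zeta^2-1)^j}X,\qquad \mathbf c(\zeta,\alpha)X=\zeta^{\alpha+s+1}\sum_{j=0}^n\frac{c_j(\alpha)}{(\zeta^2-1)^j}X,$$ $$\mathbf f(\zeta,\alpha)X=\zeta^{\alpha+s+1}\Bigl[\sum_{j=0}^n\frac{f_j(\alpha)}{(\zeta^2-1)^j}+\sum_{j=0}^s\frac{\kappa_j(\alpha)\,\zeta^{-2j}}{q^{\alpha+s+1-2j}-q^{2j-\alpha-s-1}}\Bigr]X,$$ where sums from $0$ or $1$ to $s$ are empty if $s$ is smaller than the lower limit, and where, for $j=1,\dots,n$, $$\bar c_j=\rho^{(0)}_j,\quad c_j=\tfrac12\bigl(q^{2j-\alpha-s-1}\rho^{(-)}_j+q^{\alpha+s+1-2j}\rho^{(+)}_j\bigr),\quad f_j=\tfrac12\bigl(q^{2j-\alpha-s-1}\rho^{(-)}_j-q^{\alpha+s+1-2j}\rho^{(+)}_j\bigr),$$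 $$\bar c_0=\tfrac12\sum_{j=1}^n(-1)^{j-1}\bar c_j,\quad c_0=\tfrac12\sum_{j=1}^n(-1)^{j-1}c_j,\quad f_0=\tfrac12\sum_{j=1}^n(-1)^{j-1}f_j,\quad \kappa_0=\tfrac12\sum_{j=1}^n(-1)^j\sum_{\varepsilon=-1}^1q^{-2\varepsilon j}\rho^{(\varepsilon)}_j .$$ -/

import Mathlib

open Complex

noncomputable section

namespace XXZ

/- Conventions.  The chain segment `[k,l]` has `n = l - k + 1` sites, labelled from left to right by
`Fin n`, and the basis of each `V_j = ℂ²` is labelled by `Fin 2` (`0` is spin up, `1` is spin down).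
The complex powers `ζ^α`, `q^α` are multivalued; they are made precise by working with logarithms:
throughout `q = exp η`, `ζ = exp u`, `q^α = exp (α η)`, `ζ^α = exp (α u)`, so that `qζ` belongs to
`u + η` and `(qζ)^α = q^α ζ^α`. -/

/-- Labels of the basis of `H_{[k,l]} = V_k ⊗ ⋯ ⊗ V_l`. -/
abbrev Conf (n : ℕ) : Type := Fin n → Fin 2

/-- `End H_{[k,l]}`. -/
abbrev Op (n : ℕ) : Type := Matrix (Conf n) (Conf n) ℂ

/-! ### Spin -/

/-- Eigenvalue of `S_{[k,l]} = ½ ∑ σ_j^z` on a basis vector. -/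
def mag {n : ℕ} (x : Conf n) : ℂ := (1 / 2 : ℂ) * ∑ j, (if x j = 0 then (1 : ℂ) else -1)

/-- The spin operator `S_{[k,l]} = ½ ∑ σ_j^z`. -/
def spinZ (n : ℕ) : Op n := Matrix.diagonal mag

/-- `X` has spin `s`: `[S_{[k,l]}, X] = s X`. -/
def HasSpin {n : ℕ} (s : ℤ) (X : Op n) : Prop := spinZ n * X - X * spinZ n = (s : ℂ) • X

/-! ### The `q`-oscillator algebra on the module `W⁺` -/

/-- The module `W⁺ = ⊕_{k ≥ 0} ℂ |k⟩`. -/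
abbrev Fock : Type := ℕ →₀ ℂ

/-- `q^{βD} |k⟩ = q^{βk} |k⟩`. -/
def qPowD (η β : ℂ) : Module.End ℂ Fock :=
  Finsupp.lsum ℂ fun k => exp (β * k * η) • Finsupp.lsingle k

/-- `a |k⟩ = (1 - q^{2k}) |k - 1⟩` (and `a |0⟩ = 0`, the coefficient being zero). -/
def oscA (η : ℂ) : Module.End ℂ Fock :=
  Finsupp.lsum ℂ fun k => (1 - exp (2 * k * η)) • Finsupp.lsingle (k - 1)

/-- `a* |k⟩ = |k + 1⟩`. -/
def oscAstar : Module.End ℂ Fock :=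
  Finsupp.lsum ℂ fun k => Finsupp.lsingle (k + 1)

open Classical in
/-- The trace over `W⁺` of an operator whose diagonal matrix elements are
`d k = ∑_m c_m q^{(2α+m)k}` (finite sum), namely `∑_m c_m / (1 - q^{2α+m})`.  This is the sum of the
geometric series `∑_k d k` when it converges, and its analytic continuation otherwise.  (The value
`0` is assigned to sequences that are not of this form.) -/
def oscTrace (η α : ℂ) (d : ℕ → ℂ) : ℂ :=
  if h : ∃ c : ℤ →₀ ℂ, ∀ k : ℕ, d k = c.sum fun m a => a * exp ((2 * α + m) * k * η) then
    h.choose.sum fun m a => a / (1 - exp ((2 * α + m) * η))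
  else 0

/-- For `q` not a root of unity the coefficients `c_m` are unique, so `oscTrace` is well defined. -/
theorem oscTrace_eq (η α : ℂ) (hq : ∀ m : ℕ, m ≠ 0 → exp (m * η) ≠ 1) (d : ℕ → ℂ) (c : ℤ →₀ ℂ)
    (hc : ∀ k : ℕ, d k = c.sum fun m a => a * exp ((2 * α + m) * k * η)) :
    oscTrace η α d = c.sum fun m a => a / (1 - exp ((2 * α + m) * η)) := by
  have hinj : Function.Injective
      (fun m : ℤ => powersHom ℂ (exp ((2 * α + m) * η))) := by
    intro m m' h
    have h1 : exp ((2 * α + m) * η) = exp ((2 * α + m') * η) := by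
      have := DFunLike.congr_fun h (Multiplicative.ofAdd 1)
      simpa [powersHom_apply] using this
    have key : ∀ a b : ℤ, a < b → exp ((2 * α + a) * η) = exp ((2 * α + b) * η) → False := by
      intro a b hab he
      obtain ⟨k, hk⟩ := Int.eq_ofNat_of_zero_le (sub_nonneg.mpr hab.le)
      apply hq k (by omega)
      have e : ((k : ℕ) : ℂ) * η = (2 * α + b) * η - (2 * α + a) * η := by
        have : ((k : ℕ) : ℂ) = (b : ℂ) - a := by
          have : ((b - a : ℤ) : ℂ) = ((k : ℤ) : ℂ) := by rw [hk]
          push_cast at this; exact this.symm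
        rw [this]; ring
      rw [e, Complex.exp_sub, he, div_self (Complex.exp_ne_zero _)]
    rcases lt_trichotomy m m' with h2 | h2 | h2
    · exact (key _ _ h2 h1).elim
    · exact h2
    · exact (key _ _ h2 h1.symm).elim
  have hli := (linearIndependent_monoidHom (Multiplicative ℕ) ℂ).comp _ hinj
  have hex : ∃ c : ℤ →₀ ℂ, ∀ k : ℕ, d k = c.sum fun m a => a * exp ((2 * α + m) * k * η) := ⟨c, hc⟩
  have heq : hex.choose = c := by
    apply hli
    funext k
    have h1 := (hex.choose_spec k.toAdd).symm.trans (hc k.toAdd)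
    have e : ∀ m : ℤ, exp ((2 * α + m) * (k.toAdd : ℕ) * η)
        = powersHom ℂ (exp ((2 * α + m) * η)) k := by
      intro m
      rw [powersHom_apply, ← Complex.exp_nat_mul]
      congr 1; ring
    simp only [e] at h1
    simpa [Finsupp.linearCombination_apply, Finsupp.sum, Finset.sum_apply] using h1
  unfold oscTrace
  rw [dif_pos hex, heq]

/-! ### `L`-operators and monodromy matrices -/

/-- `End (Osc_A ⊗ H_{[k,l]})`, as matrices with entries acting on `W⁺`. -/
abbrev OpA (n : ℕ) : Type := Matrix (Conf n) (Conf n) (Module.End ℂ Fock)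

/-- `End (V_a ⊗ Osc_A ⊗ H_{[k,l]})`, with `V_a = ℂ²`. -/
abbrev OpaA (n : ℕ) : Type :=
  Matrix (Fin 2 × Conf n) (Fin 2 × Conf n) (Module.End ℂ Fock)

/-- The `R`-matrix of the six-vertex model at `ζ = exp u`, as an operator on `ℂ² ⊗ ℂ²`. -/
def sixVertexR (η u : ℂ) : Matrix (Fin 2 × Fin 2) (Fin 2 × Fin 2) ℂ :=
  Matrix.of fun p p' =>
    if p = p' then
      if p.1 = p.2 then 1
      else (1 - exp (2 * u)) * exp η / (1 - exp (2 * η) * exp (2 * u))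
    else if p.1 = p'.2 ∧ p.2 = p'.1 then
      (1 - exp (2 * η)) * exp u / (1 - exp (2 * η) * exp (2 * u))
    else 0

/-- `L_{a,j}(ζ)`, i.e. `R_{a,j}(ζ)` acting on `V_a` and site `j`.  The scalar normalisation factor of
`L_{a,j}` is left out, since `L_{a,j}` is only used through conjugation. -/
def Lfund (n : ℕ) (η u : ℂ) (j : Fin n) : OpaA n :=
  Matrix.of fun p p' =>
    if ∀ i, i ≠ j → p.2 i = p'.2 i then
      algebraMap ℂ (Module.End ℂ Fock) (sixVertexR η u (p.1, p.2 j) (p'.1, p'.2 j))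
    else 0

/-- The two by two matrix with entries in `Osc` that defines `L_{A,j}(ζ)`. -/
def oscLmat (η u : ℂ) : Matrix (Fin 2) (Fin 2) (Module.End ℂ Fock) :=
  !![1 - exp (2 * u + 2 * η) • qPowD η 2, -(exp u • oscA η);
     -(exp u • oscAstar), 1] *
  !![qPowD η (-1), 0; 0, qPowD η 1]

/-- `L_{A,j}(ζ)`, again without its scalar normalisation factor, which drops out in conjugations. -/
def Losc (n : ℕ) (η u : ℂ) (j : Fin n) : OpA n :=
  Matrix.of fun x y =>
    if ∀ i, i ≠ j → x i = y i then oscLmat η u (x j) (y j) else 0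

/-- Adjoint action `Z ↦ L Z L⁻¹`. -/
def adj {R : Type*} [Ring R] (L Z : R) : R := L * Z * Ring.inverse L

/-- `𝕋_{A,[k,l]}(ζ,α) (id_A ⊗ X) = 𝕃_{A,l}(ζ) ⋯ 𝕃_{A,k}(ζ) q^{2αD_A} (id_A ⊗ X)`. -/
def monoOsc (n : ℕ) (η α u : ℂ) (X : Op n) : OpA n :=
  (List.finRange n).foldl (fun Z j => adj (Losc n η u j) Z)
    (Matrix.of fun x y => X x y • qPowD η (2 * α))

/-- `𝕋_{a,[k,l]}(ζ,α) (id_a ⊗ Z) = 𝕃_{a,l}(ζ) ⋯ 𝕃_{a,k}(ζ) q^{ασ_a^z} (id_a ⊗ Z)`. -/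
def monoFund (n : ℕ) (η α u : ℂ) (Z : OpA n) : OpaA n :=
  (List.finRange n).foldl (fun Y j => adj (Lfund n η u j) Y)
    (Matrix.of fun p p' =>
      if p.1 = p'.1 then exp ((if p.1 = 0 then α else -α) * η) • Z p.2 p'.2 else 0)

/-! ### The operator `k(ζ,α)` -/

/-- `ζ^{α-𝕊} (q^{-2S} X)`; the matrix unit `|x⟩⟨y|` has spin `mag x - mag y`. -/
def dressed {n : ℕ} (η α u : ℂ) (X : Op n) : Op n :=
  Matrix.of fun x y =>
    exp ((α - (mag x - mag y)) * u) * (exp (-2 * mag x * η) * X x y)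

/-- `σ_a^+` on `V_a ⊗ Osc_A ⊗ H_{[k,l]}`. -/
def sigmaPlus (n : ℕ) : OpaA n :=
  Matrix.of fun p p' => if p.1 = 0 ∧ p'.1 = 1 ∧ p.2 = p'.2 then 1 else 0

/-- `k(ζ,α) X = tr_{A,a} {σ_a^+ 𝕋_a(ζ,α) 𝕋_A(ζ,α) ζ^{α-𝕊} (id_{A,a} ⊗ q^{-2S} X)}`. -/
def kOp {n : ℕ} (η α u : ℂ) (X : Op n) : Op n :=
  Matrix.of fun x y => oscTrace η α fun m =>
    ∑ a : Fin 2, (sigmaPlus n * monoFund n η α u (monoOsc n η α u (dressed η α u X)))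
      (a, x) (a, y) (Finsupp.single m 1) m

/-- `k_skal(ζ,α) X = ζ^{-α-s-1} k(ζ,α) X` for `X` of spin `s`. -/
def kSkal {n : ℕ} (η α : ℂ) (s : ℤ) (u : ℂ) (X : Op n) : Op n :=
  exp (-(α + s + 1) * u) • kOp η α u X

/-- The operators `ρ ε j = ρ_j^{(ε)}(α)` (`ε = 0, ±1`, `1 ≤ j ≤ n`) and `κ j = κ_j(α)`
(`1 ≤ j ≤ s`) are the coefficients of the partial fraction decomposition of `k_skal`, as a function
of `ζ²`, on the operators of spin `s`. -/
def IsPartialFraction {n : ℕ} (η α : ℂ) (s : ℤ) (ρ : ℤ → ℕ → Op n →ₗ[ℂ] Op n)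
    (κ : ℕ → Op n →ₗ[ℂ] Op n) : Prop :=
  ∀ X : Op n, HasSpin s X → ∀ u : ℂ,
    (∀ ε ∈ Finset.Icc (-1 : ℤ) 1, exp (2 * u) ≠ exp (2 * ε * η)) →
    kSkal η α s u X =
      ∑ j ∈ Finset.Icc 1 n, ∑ ε ∈ Finset.Icc (-1 : ℤ) 1,
        ((exp (2 * u) - exp (2 * ε * η)) ^ j)⁻¹ • ρ ε j X
      + ∑ j ∈ Finset.Icc 1 s.toNat, (exp (2 * u) ^ j)⁻¹ • κ j X

/-! ### The operators `c̄`, `c` and `f` -/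

/-- `ψ(ζ,α) = ζ^α (ζ² + 1) / (2 (ζ² - 1))`. -/
def psi (u α : ℂ) : ℂ := exp (α * u) * (exp (2 * u) + 1) / (2 * (exp (2 * u) - 1))

/-- The circle of radius `r` around `ξ² = 1` is small: `0`, `ζ²`, `q^{±2}` and `q^{±4}`, the other
singularities of the integrands below, lie outside of it. -/
def SmallCircle (η u : ℂ) (r : ℝ) : Prop :=
  0 < r ∧ r < 1 ∧ r < ‖exp (2 * u) - 1‖ ∧
    ∀ m ∈ Finset.Icc (-2 : ℤ) 2, m ≠ 0 → r < ‖exp (2 * m * η) - 1‖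

/-- `∮ dξ²/(2πi ξ²) ψ(ζ/ξ, α+s+1) F(ξ)`, taken entrywise along the circle of radius `r` around
`ξ² = 1`.  The integration variable is `w = ξ²`, and `ξ = exp (½ log w)`. -/
def contourInt {n : ℕ} (α : ℂ) (s : ℤ) (r : ℝ) (u : ℂ) (F : ℂ → Op n) : Op n :=
  Matrix.of fun x y => (2 * Real.pi * I)⁻¹ *
    ∮ w in C(1, r), w⁻¹ * psi (u - log w / 2) (α + s + 1) * F (log w / 2) x y

/-- `c̄(ζ,α) X`. -/
def cBar {n : ℕ} (η α : ℂ) (s : ℤ) (r : ℝ) (u : ℂ) (X : Op n) : Op n :=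
  contourInt α s r u fun v => kOp η α v X

/-- `c(ζ,α) X`. -/
def cOp {n : ℕ} (η α : ℂ) (s : ℤ) (r : ℝ) (u : ℂ) (X : Op n) : Op n :=
  (1 / 2 : ℂ) • contourInt α s r u fun v => kOp η α (v + η) X + kOp η α (v - η) X

/-- `f^sing(ζ,α) X`. -/
def fSing {n : ℕ} (η α : ℂ) (s : ℤ) (r : ℝ) (u : ℂ) (X : Op n) : Op n :=
  (1 / 2 : ℂ) • contourInt α s r u fun v => -kOp η α (v + η) X + kOp η α (v - η) X

/-- `g` is the regular part `f^reg(ζ,α) X` of `f(ζ,α) X`: it is `ζ^{α+s+1}` times a Laurent polynomial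
in `ζ²`, and with `f = f^sing + g` it satisfies
`k(ζ,α) X = (c̄(ζ,α) + c(qζ,α) + c(q⁻¹ζ,α) + f(qζ,α) - f(q⁻¹ζ,α)) X`. -/
def IsRegularPart {n : ℕ} (η α : ℂ) (s : ℤ) (X : Op n) (g : ℂ → Op n) : Prop :=
  (∃ G : ℤ →₀ Op n, ∀ u, g u = exp ((α + s + 1) * u) • G.sum fun m A => exp (2 * m * u) • A) ∧
  ∀ (u : ℂ) (r : ℝ), SmallCircle η u r → SmallCircle η (u + η) r → SmallCircle η (u - η) r →
    kOp η α u X = cBar η α s r u X + cOp η α s r (u + η) X + cOp η α s r (u - η) X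
      + (fSing η α s r (u + η) X + g (u + η)) - (fSing η α s r (u - η) X + g (u - η))

open Classical in
/-- `f^reg(ζ,α) X`. -/
def fReg {n : ℕ} (η α : ℂ) (s : ℤ) (u : ℂ) (X : Op n) : Op n :=
  if h : ∃ g, IsRegularPart η α s X g then h.choose u else 0

/-- `f(ζ,α) X = (f^sing(ζ,α) + f^reg(ζ,α)) X`. -/
def fOp {n : ℕ} (η α : ℂ) (s : ℤ) (r : ℝ) (u : ℂ) (X : Op n) : Op n :=
  fSing η α s r u X + fReg η α s u X

/-! ### The coefficients -/

/-- Extends coefficients `a_j`, `j ≥ 1`, by `a_0 = ½ ∑_{j=1}^n (-1)^{j-1} a_j`. -/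
def withZeroth {n : ℕ} (a : ℕ → Op n →ₗ[ℂ] Op n) (j : ℕ) : Op n →ₗ[ℂ] Op n :=
  if j = 0 then (1 / 2 : ℂ) • ∑ i ∈ Finset.Icc 1 n, (-1 : ℂ) ^ (i - 1) • a i else a j

/-- `c̄_j(α)`. -/
def cBarCoeff {n : ℕ} (ρ : ℤ → ℕ → Op n →ₗ[ℂ] Op n) : ℕ → Op n →ₗ[ℂ] Op n :=
  withZeroth fun j => ρ 0 j

/-- `c_j(α)`. -/
def cCoeff {n : ℕ} (η α : ℂ) (s : ℤ) (ρ : ℤ → ℕ → Op n →ₗ[ℂ] Op n) : ℕ → Op n →ₗ[ℂ] Op n :=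
  withZeroth fun j => (1 / 2 : ℂ) •
    (exp ((2 * j - α - s - 1) * η) • ρ (-1) j + exp ((α + s + 1 - 2 * j) * η) • ρ 1 j)

/-- `f_j(α)`. -/
def fCoeff {n : ℕ} (η α : ℂ) (s : ℤ) (ρ : ℤ → ℕ → Op n →ₗ[ℂ] Op n) : ℕ → Op n →ₗ[ℂ] Op n :=
  withZeroth fun j => (1 / 2 : ℂ) •
    (exp ((2 * j - α - s - 1) * η) • ρ (-1) j - exp ((α + s + 1 - 2 * j) * η) • ρ 1 j)

/-- `κ_j(α)`, `j ≥ 0`, where `κ_0 = ½ ∑_{j=1}^n (-1)^j ∑_ε q^{-2εj} ρ_j^{(ε)}`. -/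
def kappaCoeff {n : ℕ} (η : ℂ) (ρ : ℤ → ℕ → Op n →ₗ[ℂ] Op n) (κ : ℕ → Op n →ₗ[ℂ] Op n) (j : ℕ) :
    Op n →ₗ[ℂ] Op n :=
  if j = 0 then (1 / 2 : ℂ) • ∑ i ∈ Finset.Icc 1 n, (-1 : ℂ) ^ i •
      ∑ ε ∈ Finset.Icc (-1 : ℤ) 1, exp (-2 * ε * i * η) • ρ ε i
  else κ j

end XXZ

end

/-! Everything reduces to rational functions of `w = ζ²`. Conjugation by `L_A` has denominator `1 -
w` per site, conjugation by `L_a` has `(1 - q²w)(q² - w)`, so the denominator of `k` has degree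
`3n`, with zeros of order `n` at `1` and `q^{±2}`. For the numerator, give `W⁺` its
occupation-number grading. A matrix element of `𝕋_A` of grade `d` is `ζ^d` times a polynomial in
`w`; only `d = 0` survives the trace, and there the degree is at most `n + s`
(`graded_foldl_adj_Losc`, `sum_weight`). The entry of `𝕋_a` picked by `σ⁺` is odd in `ζ` of degree
at most `4n`, hence `ζ` times a polynomial in `w` of degree at most `2n - 1` (`foldl_adj_Lfund`).
Thus `k_skal` is `w^{-s}` times a polynomial of degree below `3n + s`, over the denominator: it is
proper, its pole at `0` has order at most `s`, and for `s < 0` it vanishes at `0`. This gives the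
partial fractions.

The kernel `ψ(ζ/ξ)/w` is `ζ^{α+s+1} ξ^{-(α+s+1)}` times `1/(z - w) + 1/(2w)`, with `z = ζ²`. If `P`
is the principal part at `w = 1` of the other factor, the integral is `P(z) - P(0)/2`
(`circleIntegral_kernel_mul`); the constants `-P(0)/2` are the zeroth coefficients. Shifting `ξ` by
`q^{±1}` brings the poles at `q^{±2}` to `1`.

Inserted into the functional equation, these integrals reproduce all poles of `k_skal` outside `0`.
What remains is `g(qζ) - g(q⁻¹ζ) = ζ^{α+s+1} ∑ κ_j ζ^{-2j}`, where `κ_0` compensates the constants.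
The difference operator acts on `ζ^{α+s+1+2m}` by `q^{α+s+1+2m} - q^{-(α+s+1+2m)}`, nonzero by the
assumption on `α`, so `g` exists and is unique. For `s < 0` the sum is empty, consistently with `κ_0
= 0`. -/

open Complex

noncomputable section

namespace XXZ

/-! ### Operators acting on one site -/

section Site

variable {E : Type*} [Ring E] {n : ℕ}

theorem sum_eq_off_site (j : Fin n) (x : Conf n) (f : Conf n → E) :
    ∑ z, (if ∀ i, i ≠ j → x i = z i then f z else 0) = ∑ a, f (Function.update x j a) := by
  rw [← Finset.sum_filter]
  symm
  refine Finset.sum_nbij' (fun a => Function.update x j a) (fun z => z j) ?_ ?_ ?_ ?_ ?_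
  · intro a _
    simp only [Finset.mem_filter, Finset.mem_univ, true_and]
    intro i hi
    rw [Function.update_of_ne hi]
  · intro z _; simp
  · intro a _; simp
  · intro z hz
    simp only [Finset.mem_filter, Finset.mem_univ, true_and] at hz
    funext i
    by_cases hi : i = j
    · subst hi; simp
    · rw [Function.update_of_ne hi, hz i hi]
  · intro a _; rfl

/-- The operator on `H` that acts by `M` on the site `j`. -/
def siteOp (j : Fin n) (M : Matrix (Fin 2) (Fin 2) E) : Matrix (Conf n) (Conf n) E :=
  Matrix.of fun x y => if ∀ i, i ≠ j → x i = y i then M (x j) (y j) else 0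

theorem siteOp_mul_apply (j : Fin n) (M : Matrix (Fin 2) (Fin 2) E)
    (Z : Matrix (Conf n) (Conf n) E) (x y : Conf n) :
    (siteOp j M * Z) x y = ∑ a, M (x j) a * Z (Function.update x j a) y := by
  simp only [Matrix.mul_apply, siteOp, Matrix.of_apply, ite_mul, zero_mul]
  rw [sum_eq_off_site j x fun z => M (x j) (z j) * Z z y]
  simp

theorem mul_siteOp_apply (j : Fin n) (M : Matrix (Fin 2) (Fin 2) E)
    (Z : Matrix (Conf n) (Conf n) E) (x y : Conf n) :
    (Z * siteOp j M) x y = ∑ b, Z x (Function.update y j b) * M b (y j) := by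
  have h : ∀ z : Conf n, (∀ i, i ≠ j → z i = y i) ↔ (∀ i, i ≠ j → y i = z i) :=
    fun z => ⟨fun h i hi => (h i hi).symm, fun h i hi => (h i hi).symm⟩
  simp only [Matrix.mul_apply, siteOp, Matrix.of_apply, mul_ite, mul_zero, h]
  rw [sum_eq_off_site j y fun z => Z x z * M (z j) (y j)]
  simp

theorem siteOp_mul (j : Fin n) (M N : Matrix (Fin 2) (Fin 2) E) :
    siteOp j M * siteOp j N = siteOp j (M * N) := by
  ext x y
  rw [siteOp_mul_apply]
  have h : ∀ a, (∀ i, i ≠ j → Function.update x j a i = y i) ↔ (∀ i, i ≠ j → x i = y i) :=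
    fun a => forall_congr' fun i => imp_congr_right fun hi => by rw [Function.update_of_ne hi]
  simp only [siteOp, Matrix.of_apply, h, Function.update_self, Matrix.mul_apply]
  split_ifs <;> simp

theorem siteOp_one (j : Fin n) : siteOp j (1 : Matrix (Fin 2) (Fin 2) E) = 1 := by
  ext x y
  simp only [siteOp, Matrix.of_apply, Matrix.one_apply]
  by_cases h : x = y
  · simp [h]
  · rw [if_neg h]
    split_ifs with h1 h2
    · exact (h (funext fun i => by by_cases hi : i = j; exacts [hi ▸ h2, h1 i hi])).elim
    · rfl
    · rfl

theorem siteOp_smul {R : Type*} [SMulZeroClass R E] (c : R) (j : Fin n)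
    (M : Matrix (Fin 2) (Fin 2) E) : siteOp j (c • M) = c • siteOp j M := by
  ext x y
  simp only [siteOp, Matrix.of_apply, Matrix.smul_apply]
  split_ifs <;> simp

/-- The operator on `V_a ⊗ H` that acts by `M` on `V_a` and the site `j`. -/
def auxSiteOp (j : Fin n) (M : Matrix (Fin 2 × Fin 2) (Fin 2 × Fin 2) E) :
    Matrix (Fin 2 × Conf n) (Fin 2 × Conf n) E :=
  Matrix.of fun p p' => if ∀ i, i ≠ j → p.2 i = p'.2 i then M (p.1, p.2 j) (p'.1, p'.2 j) else 0

theorem auxSiteOp_mul_apply (j : Fin n) (M : Matrix (Fin 2 × Fin 2) (Fin 2 × Fin 2) E)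
    (Z : Matrix (Fin 2 × Conf n) (Fin 2 × Conf n) E) (p q : Fin 2 × Conf n) :
    (auxSiteOp j M * Z) p q =
      ∑ a : Fin 2 × Fin 2, M (p.1, p.2 j) a * Z (a.1, Function.update p.2 j a.2) q := by
  simp only [Matrix.mul_apply, auxSiteOp, Matrix.of_apply, ite_mul, zero_mul,
    Fintype.sum_prod_type]
  refine Finset.sum_congr rfl fun b _ => ?_
  rw [sum_eq_off_site j p.2 fun z => M (p.1, p.2 j) (b, z j) * Z (b, z) q]
  simp

theorem mul_auxSiteOp_apply (j : Fin n) (M : Matrix (Fin 2 × Fin 2) (Fin 2 × Fin 2) E)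
    (Z : Matrix (Fin 2 × Conf n) (Fin 2 × Conf n) E) (p q : Fin 2 × Conf n) :
    (Z * auxSiteOp j M) p q =
      ∑ b : Fin 2 × Fin 2, Z p (b.1, Function.update q.2 j b.2) * M b (q.1, q.2 j) := by
  have h : ∀ z : Conf n, (∀ i, i ≠ j → z i = q.2 i) ↔ (∀ i, i ≠ j → q.2 i = z i) :=
    fun z => ⟨fun h i hi => (h i hi).symm, fun h i hi => (h i hi).symm⟩
  simp only [Matrix.mul_apply, auxSiteOp, Matrix.of_apply, mul_ite, mul_zero,
    Fintype.sum_prod_type, h]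
  refine Finset.sum_congr rfl fun b _ => ?_
  rw [sum_eq_off_site j q.2 fun z => Z p (b, z) * M (b, z j) (q.1, q.2 j)]
  simp

theorem auxSiteOp_mul (j : Fin n) (M N : Matrix (Fin 2 × Fin 2) (Fin 2 × Fin 2) E) :
    auxSiteOp j M * auxSiteOp j N = auxSiteOp j (M * N) := by
  ext p q
  rw [auxSiteOp_mul_apply]
  have h : ∀ a, (∀ i, i ≠ j → Function.update p.2 j a i = q.2 i) ↔ (∀ i, i ≠ j → p.2 i = q.2 i) :=
    fun a => forall_congr' fun i => imp_congr_right fun hi => by rw [Function.update_of_ne hi]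
  simp only [auxSiteOp, Matrix.of_apply, h, Function.update_self, Matrix.mul_apply]
  split_ifs <;> simp

theorem auxSiteOp_one (j : Fin n) :
    auxSiteOp j (1 : Matrix (Fin 2 × Fin 2) (Fin 2 × Fin 2) E) = 1 := by
  ext p q
  simp only [auxSiteOp, Matrix.of_apply, Matrix.one_apply]
  by_cases h : p = q
  · simp [h]
  · rw [if_neg h]
    split_ifs with h1 h2
    · refine (h (Prod.ext (Prod.ext_iff.1 h2).1 (funext fun i => ?_))).elim
      by_cases hi : i = j
      exacts [hi ▸ (Prod.ext_iff.1 h2).2, h1 i hi]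
    · rfl
    · rfl

end Site

/-- Conjugation by `L` in terms of an inverse of `L` up to a scalar. -/
theorem smul_adj {R : Type*} [Ring R] [Algebra ℂ R] {c : ℂ} (hc : c ≠ 0) {L N : R}
    (h₁ : L * N = c • 1) (h₂ : N * L = c • 1) (Z : R) : c • adj L Z = L * Z * N := by
  let v : Rˣ := ⟨L, c⁻¹ • N, by rw [mul_smul_comm, h₁, smul_smul, inv_mul_cancel₀ hc, one_smul],
    by rw [smul_mul_assoc, h₂, smul_smul, inv_mul_cancel₀ hc, one_smul]⟩
  have : Ring.inverse L = c⁻¹ • N := Ring.inverse_unit v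
  rw [adj, this, mul_smul_comm, smul_smul, mul_inv_cancel₀ hc, one_smul]

theorem adj_add {R : Type*} [Ring R] (L Z Z' : R) : adj L (Z + Z') = adj L Z + adj L Z' := by
  simp [adj, mul_add, add_mul]

theorem adj_smul {R : Type*} [Ring R] [Algebra ℂ R] (c : ℂ) (L Z : R) :
    adj L (c • Z) = c • adj L Z := by
  simp [adj]

/-! ### The `L`-operators and their inverses -/

theorem qPowD_single (η β : ℂ) (k : ℕ) :
    qPowD η β (Finsupp.single k 1) = exp (β * k * η) • Finsupp.single k 1 := by
  simp [qPowD]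

theorem oscA_single (η : ℂ) (k : ℕ) :
    oscA η (Finsupp.single k 1) = (1 - exp (2 * k * η)) • Finsupp.single (k - 1) 1 := by
  simp [oscA]

theorem oscAstar_single (k : ℕ) :
    oscAstar (Finsupp.single k 1) = Finsupp.single (k + 1) 1 := by
  simp [oscAstar]

theorem fock_end_ext {S T : Module.End ℂ Fock}
    (h : ∀ k, S (Finsupp.single k 1) = T (Finsupp.single k 1)) : S = T := by
  refine Finsupp.lhom_ext fun k b => ?_
  have : Finsupp.single k b = b • Finsupp.single k (1 : ℂ) := by simp
  rw [this, map_smul, map_smul, h]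

theorem qPowD_mul (η β γ : ℂ) : qPowD η β * qPowD η γ = qPowD η (β + γ) := by
  refine fock_end_ext fun k => ?_
  simp only [Module.End.mul_apply, qPowD_single, map_smul, smul_smul, ← exp_add]
  congr 2; ring

theorem qPowD_zero (η : ℂ) : qPowD η 0 = 1 := by
  refine fock_end_ext fun k => ?_
  simp [qPowD_single]

theorem oscA_mul_qPowD (η β : ℂ) :
    oscA η * qPowD η β = exp (β * η) • (qPowD η β * oscA η) := by
  refine fock_end_ext fun k => ?_
  -- At `k = 0` the truncated `k - 1` is wrong, but the coefficient `1 - q^{2k}` vanishes.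
  rcases k with _ | k
  · simp [qPowD_single, oscA_single]
  · simp only [Module.End.mul_apply, LinearMap.smul_apply, qPowD_single, oscA_single, map_smul,
      smul_smul]
    congr 1
    rw [mul_left_comm, ← exp_add, mul_comm]
    congr 2
    push_cast [Nat.add_sub_cancel]; ring

theorem qPowD_mul_oscAstar (η β : ℂ) :
    qPowD η β * oscAstar = exp (β * η) • (oscAstar * qPowD η β) := by
  refine fock_end_ext fun k => ?_
  simp only [Module.End.mul_apply, LinearMap.smul_apply, qPowD_single, oscAstar_single, map_smul,
      smul_smul, ← exp_add]
  congr 2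
  push_cast; ring

theorem oscA_mul_oscAstar (η : ℂ) :
    oscA η * oscAstar = 1 - exp (2 * η) • qPowD η 2 := by
  refine fock_end_ext fun k => ?_
  simp only [Module.End.mul_apply, LinearMap.smul_apply, LinearMap.sub_apply, Module.End.one_apply,
    qPowD_single, oscAstar_single, oscA_single, Nat.add_sub_cancel, sub_smul, one_smul, smul_smul,
    ← exp_add]
  congr 3
  push_cast; ring

theorem oscAstar_mul_oscA (η : ℂ) : oscAstar * oscA η = 1 - qPowD η 2 := by
  refine fock_end_ext fun k => ?_
  rcases k with _ | k
  · simp [qPowD_single, oscA_single]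
  · simp only [Module.End.mul_apply, LinearMap.sub_apply, Module.End.one_apply,
      qPowD_single, oscA_single, Nat.add_sub_cancel, map_smul, oscAstar_single]
    rw [sub_smul, one_smul]

section Quantum

variable {E : Type*} [Ring E] [Algebra ℂ E] {a b Q D D' : E} {z w c : ℂ}

/-- To be read with `Q = q^{2D}`, `D = q^D`, `D' = q^{-D}`, `c = q²`, `w = ζ²`: `B` is a quantum
adjugate and `1 - w` the quantum determinant. The opposite product needs its own proof, as a
one-sided inverse need not be two-sided in the oscillator algebra. -/
theorem osc_mul_osc_inv (hw : w = z * z) (hab : a * b = 1 - c • Q) (hba : b * a = 1 - Q)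
    (haQ : a * Q = c • (Q * a)) (hD : D * D' = 1) (hD' : D' * D = 1)
    {A B : Matrix (Fin 2) (Fin 2) E}
    (hA : A = !![(1 - (w * c) • Q) * D', -(z • a) * D; -(z • b) * D', D])
    (hB : B = !![D, D * (z • a); D' * (z • b), D' * (1 - w • Q)]) :
    A * B = (1 - w) • 1 := by
  subst hw hA hB
  have h₁ : ∀ x, D * (D' * x) = x := fun x => by rw [← mul_assoc, hD, one_mul]
  have h₂ : ∀ x, D' * (D * x) = x := fun x => by rw [← mul_assoc, hD', one_mul]
  rw [Matrix.mul_fin_two, Matrix.one_fin_two]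
  ext1 i j
  fin_cases i <;> fin_cases j
  · simp [mul_assoc, h₁, hD', hab, smul_smul]; module
  · simp [mul_assoc, h₁, h₂, hD, sub_mul, mul_sub, haQ]; module
  · simp [mul_assoc, h₁, hD']
  · simp [mul_assoc, h₁, h₂, hba]; module

theorem osc_inv_mul_osc (hw : w = z * z) (hab : a * b = 1 - c • Q) (hba : b * a = 1 - Q)
    (hQb : Q * b = c • (b * Q)) (hD : D * D' = 1) (hD' : D' * D = 1)
    {A B : Matrix (Fin 2) (Fin 2) E}
    (hA : A = !![(1 - (w * c) • Q) * D', -(z • a) * D; -(z • b) * D', D])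
    (hB : B = !![D, D * (z • a); D' * (z • b), D' * (1 - w • Q)]) :
    B * A = (1 - w) • 1 := by
  subst hw hA hB
  have h₁ : ∀ x, Q * (b * x) = c • (b * (Q * x)) := fun x => by
    rw [← mul_assoc, hQb, smul_mul_assoc, mul_assoc]
  have h₂ : ∀ x, a * (b * x) = x - c • (Q * x) := fun x => by
    rw [← mul_assoc, hab, sub_mul, one_mul, smul_mul_assoc]
  have h₃ : ∀ x, b * (a * x) = x - Q * x := fun x => by rw [← mul_assoc, hba, sub_mul, one_mul]
  rw [Matrix.mul_fin_two, Matrix.one_fin_two]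
  ext1 i j
  fin_cases i <;> fin_cases j
  · simp [mul_assoc, sub_mul, mul_sub, hD, h₂]; module
  · simp [mul_assoc]
  · simp [mul_assoc, sub_mul, mul_sub, h₁]; module
  · simp [mul_assoc, sub_mul, mul_sub, hD', h₃]; module

end Quantum

theorem exp_two_mul (u : ℂ) : exp (2 * u) = exp u * exp u := by rw [← exp_add]; ring_nf

theorem oscLmat_eq (η u : ℂ) : oscLmat η u =
    !![(1 - (exp (2 * u) * exp (2 * η)) • qPowD η 2) * qPowD η (-1), -(exp u • oscA η) * qPowD η 1;
      -(exp u • oscAstar) * qPowD η (-1), qPowD η 1] := by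
  ext1 i j
  fin_cases i <;> fin_cases j <;> simp [oscLmat, Matrix.mul_apply, exp_add]

/-- `(1 - ζ²)` times the inverse of the matrix `oscLmat`. -/
def oscLinv (η u : ℂ) : Matrix (Fin 2) (Fin 2) (Module.End ℂ Fock) :=
  !![qPowD η 1, qPowD η 1 * (exp u • oscA η);
    qPowD η (-1) * (exp u • oscAstar), qPowD η (-1) * (1 - exp (2 * u) • qPowD η 2)]

theorem qPowD_one_mul_neg_one (η : ℂ) : qPowD η 1 * qPowD η (-1) = 1 := by
  rw [qPowD_mul, add_neg_cancel, qPowD_zero]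

theorem qPowD_neg_one_mul_one (η : ℂ) : qPowD η (-1) * qPowD η 1 = 1 := by
  rw [qPowD_mul, neg_add_cancel, qPowD_zero]

theorem oscLmat_mul_oscLinv (η u : ℂ) :
    oscLmat η u * oscLinv η u = (1 - exp (2 * u)) • 1 :=
  osc_mul_osc_inv (E := Module.End ℂ Fock) (exp_two_mul u) (oscA_mul_oscAstar η)
    (oscAstar_mul_oscA η) (oscA_mul_qPowD η 2) (qPowD_one_mul_neg_one η) (qPowD_neg_one_mul_one η) (oscLmat_eq η u) rfl

theorem oscLinv_mul_oscLmat (η u : ℂ) :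
    oscLinv η u * oscLmat η u = (1 - exp (2 * u)) • 1 :=
  osc_inv_mul_osc (E := Module.End ℂ Fock) (exp_two_mul u) (oscA_mul_oscAstar η)
    (oscAstar_mul_oscA η) (qPowD_mul_oscAstar η 2) (qPowD_one_mul_neg_one η) (qPowD_neg_one_mul_one η)
    (oscLmat_eq η u) rfl

theorem smul_adj_Losc {n : ℕ} {η u : ℂ} (hu : exp (2 * u) ≠ 1) (j : Fin n) (Z : OpA n) :
    (1 - exp (2 * u)) • adj (Losc n η u j) Z =
      siteOp j (oscLmat η u) * Z * siteOp j (oscLinv η u) := by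
  refine smul_adj (sub_ne_zero.2 hu.symm) ?_ ?_ Z
  · change siteOp j (oscLmat η u) * _ = _
    rw [siteOp_mul, oscLmat_mul_oscLinv, siteOp_smul, siteOp_one]
  · change _ * siteOp j (oscLmat η u) = _
    rw [siteOp_mul, oscLinv_mul_oscLmat, siteOp_smul, siteOp_one]

/-- Unitarity `R(ζ) R(ζ⁻¹) = 1`. The excluded values `ζ² = q^{-2}` and `ζ² = q²` are the poles of
the first and of the second factor. -/
theorem sixVertexR_mul_neg {η u : ℂ} (h₁ : exp (2 * u) ≠ exp (2 * η))
    (h₂ : exp (2 * u) ≠ exp (-(2 * η))) : sixVertexR η u * sixVertexR η (-u) = 1 := by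
  have hw : exp (2 * u) ≠ 0 := exp_ne_zero _
  have hz : exp u ≠ 0 := exp_ne_zero _
  have hsq : exp (2 * u) = exp u ^ 2 := by rw [← exp_nat_mul]; norm_num
  have hqq : exp (2 * η) = exp η ^ 2 := by rw [← exp_nat_mul]; norm_num
  have hd₁ : 1 - exp u ^ 2 * exp η ^ 2 ≠ 0 := by
    rw [← hqq, ← hsq, sub_ne_zero]
    intro h
    apply h₂
    rw [exp_neg]
    exact eq_inv_of_mul_eq_one_left h.symm
  have hd₁' : 1 - exp η ^ 2 * exp u ^ 2 ≠ 0 := by rwa [mul_comm]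
  have hd₂ : exp u ^ 2 - exp η ^ 2 ≠ 0 := by rw [← hqq, ← hsq]; exact sub_ne_zero.2 h₁
  have hd₃ : 1 - exp η ^ 2 * (exp u ^ 2)⁻¹ ≠ 0 := by
    intro h; apply hd₂; field_simp at h; simpa using h
  ext ⟨a, b⟩ ⟨c, d⟩
  fin_cases a <;> fin_cases b <;> fin_cases c <;> fin_cases d <;>
  · simp [Matrix.mul_apply, Fintype.sum_prod_type, sixVertexR, hsq, hqq, exp_neg]
    try (field_simp; try ring)

theorem smul_adj_Lfund {n : ℕ} {η u : ℂ} (h₁ : exp (2 * u) ≠ exp (2 * η))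
    (h₂ : exp (2 * u) ≠ exp (-(2 * η))) (j : Fin n) (Z : OpaA n) :
    adj (Lfund n η u j) Z =
      auxSiteOp j ((sixVertexR η u).map (algebraMap ℂ (Module.End ℂ Fock))) * Z *
        auxSiteOp j ((sixVertexR η (-u)).map (algebraMap ℂ (Module.End ℂ Fock))) := by
  rw [← one_smul ℂ (adj (Lfund n η u j) Z)]
  refine smul_adj one_ne_zero ?_ ?_ Z
  · change auxSiteOp j ((sixVertexR η u).map (algebraMap ℂ (Module.End ℂ Fock))) * _ = _
    rw [auxSiteOp_mul, ← Matrix.map_mul, sixVertexR_mul_neg h₁ h₂]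
    simp [auxSiteOp_one]
  · change _ * auxSiteOp j ((sixVertexR η u).map (algebraMap ℂ (Module.End ℂ Fock))) = _
    have := sixVertexR_mul_neg h₁ h₂
    rw [auxSiteOp_mul, ← Matrix.map_mul, mul_eq_one_comm.1 this]
    simp [auxSiteOp_one]

/-! ### Graded families of operators on `W⁺` -/

/-- The functions of `ζ` and `k` that are polynomials of degree at most `N` in `ζ²` with
coefficients in `q^{2αek} ℂ[q^k, q^{-k}]`. -/
def polyFns (η α : ℂ) (e N : ℕ) : Submodule ℂ (ℂ → ℤ → ℂ) :=
  Submodule.span ℂ {f | ∃ i ≤ N, ∃ m : ℤ,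
    f = fun (u : ℂ) (k : ℤ) => exp (2 * i * u) * exp ((2 * α * e + m) * k * η)}

section Graded

variable {η α : ℂ} {e e' N N' : ℕ}

theorem mem_polyFns {i : ℕ} (hi : i ≤ N) (m : ℤ) :
    (fun (u : ℂ) (k : ℤ) => exp (2 * i * u) * exp ((2 * α * e + m) * k * η)) ∈
      polyFns η α e N :=
  Submodule.subset_span ⟨i, hi, m, rfl⟩

theorem polyFns_mono (h : N ≤ N') : polyFns η α e N ≤ polyFns η α e N' :=
  Submodule.span_mono fun _ ⟨i, hi, m, hf⟩ => ⟨i, hi.trans h, m, hf⟩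

theorem mul_mem_polyFns {f g : ℂ → ℤ → ℂ} (hf : f ∈ polyFns η α e N)
    (hg : g ∈ polyFns η α e' N') : f * g ∈ polyFns η α (e + e') (N + N') := by
  have h := Submodule.mul_mem_mul hf hg
  rw [polyFns, polyFns, Submodule.span_mul_span] at h
  refine Submodule.span_mono ?_ h
  rintro _ ⟨_, ⟨i, hi, m, rfl⟩, _, ⟨i', hi', m', rfl⟩, rfl⟩
  refine ⟨i + i', by omega, m + m', ?_⟩
  funext u k
  simp only [Pi.mul_apply, ← exp_add]
  congr 1
  push_cast; ring

/-- Shifting `k` multiplies each exponential in `k` by a constant. -/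
theorem shift_mem_polyFns {f : ℂ → ℤ → ℂ} (hf : f ∈ polyFns η α e N) (d : ℤ) :
    (fun u k => f u (k + d)) ∈ polyFns η α e N := by
  induction hf using Submodule.span_induction with
  | mem f hf =>
    obtain ⟨i, hi, m, rfl⟩ := hf
    have : (fun (u : ℂ) (k : ℤ) => exp (2 * i * u) * exp ((2 * α * e + m) * (k + d : ℤ) * η)) =
        exp ((2 * α * e + m) * d * η) •
          fun (u : ℂ) (k : ℤ) => exp (2 * i * u) * exp ((2 * α * e + m) * k * η) := by
      funext u k
      simp only [Pi.smul_apply, smul_eq_mul, ← exp_add]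
      congr 1
      push_cast; ring
    rw [this]
    exact Submodule.smul_mem _ _ (mem_polyFns hi m)
  | zero => exact Submodule.zero_mem _
  | add f g _ _ hf hg => exact Submodule.add_mem _ hf hg
  | smul c f _ hf => exact Submodule.smul_mem _ c hf

/-- A family `T u` of operators on `W⁺`, `u ∈ U`, with
`T |k⟩ = ζ^d f(ζ², k) |k + d⟩`, where `f` belongs to `polyFns`. -/
def Graded (η α : ℂ) (U : Set ℂ) (e N : ℕ) (d : ℤ) (T : ℂ → Module.End ℂ Fock) : Prop :=
  ∃ f ∈ polyFns η α e N, (∀ u ∈ U, ∀ k : ℕ, (k : ℤ) + d < 0 → f u k = 0) ∧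
    ∀ u ∈ U, ∀ k : ℕ, T u (Finsupp.single k 1) =
      (exp (d * u) * f u k) • Finsupp.single ((k : ℤ) + d).toNat 1

variable {U : Set ℂ} {d d' : ℤ} {T T' : ℂ → Module.End ℂ Fock}

theorem Graded.congr (h : Graded η α U e N d T) (hT : ∀ u ∈ U, T' u = T u) :
    Graded η α U e N d T' := by
  obtain ⟨f, hf, hf0, hfT⟩ := h
  exact ⟨f, hf, hf0, fun u hu k => by rw [hT u hu, hfT u hu]⟩

theorem Graded.mono (h : Graded η α U e N d T) (hN : N ≤ N') : Graded η α U e N' d T := by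
  obtain ⟨f, hf, h⟩ := h
  exact ⟨f, polyFns_mono hN hf, h⟩

theorem Graded.zero : Graded η α U e N d fun _ => 0 :=
  ⟨0, Submodule.zero_mem _, by simp, by simp⟩

theorem Graded.add (h : Graded η α U e N d T) (h' : Graded η α U e N d T') :
    Graded η α U e N d fun u => T u + T' u := by
  obtain ⟨f, hf, hf0, hfT⟩ := h
  obtain ⟨f', hf', hf0', hfT'⟩ := h'
  refine ⟨f + f', Submodule.add_mem _ hf hf', fun u hu k hk => ?_, fun u hu k => ?_⟩
  · simp [hf0 u hu k hk, hf0' u hu k hk]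
  · simp [hfT u hu, hfT' u hu, mul_add, add_smul]

theorem Graded.sum {ι : Type*} (s : Finset ι) {T : ι → ℂ → Module.End ℂ Fock}
    (h : ∀ i ∈ s, Graded η α U e N d (T i)) : Graded η α U e N d fun u => ∑ i ∈ s, T i u := by
  classical
  induction s using Finset.induction_on with
  | empty => simpa using Graded.zero
  | insert i s hi ih =>
    simp only [Finset.sum_insert hi]
    exact (h i (by simp)).add (ih fun j hj => h j (by simp [hj]))

/-- The coefficient of the left factor is evaluated at `k + d'`, which is why coefficients are
functions on `ℤ`. If `k + d'` is negative, the right factor already vanishes, so the truncation in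
`toNat` does no harm. -/
theorem Graded.mul (h : Graded η α U e N d T) (h' : Graded η α U e' N' d' T') :
    Graded η α U (e + e') (N + N') (d + d') fun u => T u * T' u := by
  obtain ⟨f, hf, hf0, hfT⟩ := h
  obtain ⟨f', hf', hf0', hfT'⟩ := h'
  refine ⟨(fun u k => f u (k + d')) * f', mul_mem_polyFns (shift_mem_polyFns hf d') hf',
    fun u hu k hk => ?_, fun u hu k => ?_⟩
  · by_cases hk' : (k : ℤ) + d' < 0
    · simp [hf0' u hu k hk']
    · obtain ⟨m, hm⟩ := Int.eq_ofNat_of_zero_le (not_lt.1 hk')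
      simp [hm, hf0 u hu m (by omega)]
  · simp only [Module.End.mul_apply, hfT' u hu, map_smul, hfT u hu, Pi.mul_apply, smul_smul]
    by_cases hk' : (k : ℤ) + d' < 0
    · simp [hf0' u hu k hk']
    · obtain ⟨m, hm⟩ := Int.eq_ofNat_of_zero_le (not_lt.1 hk')
      rw [show ((k : ℤ) + d').toNat = m by omega, hm,
        show (k : ℤ) + (d + d') = (m : ℤ) + d by omega]
      congr 1
      push_cast
      rw [add_mul, exp_add]
      ring

theorem Graded.smul (h : Graded η α U e N d T) (c : ℂ) :
    Graded η α U e N d fun u => c • T u := by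
  obtain ⟨f, hf, hf0, hfT⟩ := h
  refine ⟨c • f, Submodule.smul_mem _ c hf, fun u hu k hk => ?_, fun u hu k => ?_⟩
  · simp [hf0 u hu k hk]
  · rw [LinearMap.smul_apply, hfT u hu, smul_smul]
    congr 1
    simp only [Pi.smul_apply, smul_eq_mul]
    ring

theorem Graded.neg (h : Graded η α U e N d T) : Graded η α U e N d fun u => -T u := by
  exact (h.smul (-1)).congr fun u _ => (neg_one_smul ℂ (T u)).symm

theorem Graded.sub (h : Graded η α U e N d T) (h' : Graded η α U e N d T') :
    Graded η α U e N d fun u => T u - T' u := by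
  exact (h.add h'.neg).congr fun u _ => sub_eq_add_neg (T u) (T' u)

theorem Graded.exp_smul (h : Graded η α U e N d T) :
    Graded η α U e (N + 1) d fun u => exp (2 * u) • T u := by
  obtain ⟨f, hf, hf0, hfT⟩ := h
  have h1 : (fun (u : ℂ) (_ : ℤ) => exp (2 * u)) ∈ polyFns η α 0 1 := by
    convert mem_polyFns (η := η) (α := α) (e := 0) le_rfl 0 using 4
    simp
  have := mul_mem_polyFns hf h1
  refine ⟨_, this, fun u hu k hk => ?_, fun u hu k => ?_⟩
  · simp [hf0 u hu k hk]
  · rw [LinearMap.smul_apply, hfT u hu, smul_smul]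
    congr 1
    simp only [Pi.mul_apply]
    ring

theorem graded_qPowD (m : ℤ) : Graded η α U 0 0 0 fun _ => qPowD η m := by
  refine ⟨_, mem_polyFns le_rfl m, fun u _ k hk => by omega, fun u _ k => ?_⟩
  rw [qPowD_single]
  simp

theorem graded_one : Graded η α U 0 0 0 fun _ => 1 := by
  simpa [qPowD_zero] using graded_qPowD (η := η) (α := α) (U := U) 0

/-- Lowering must carry `ζ^{-1}`, and `ζ = ζ^{-1} ζ²`, so `ζ a` costs one degree in `ζ²`, whereas `ζ
a*` costs none. -/
theorem graded_oscA : Graded η α U 0 1 (-1) fun u => exp u • oscA η := by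
  refine ⟨_, Submodule.sub_mem _ (mem_polyFns (i := 1) le_rfl 0) (mem_polyFns (i := 1) le_rfl 2),
    fun u _ k hk => ?_, fun u _ k => ?_⟩
  · obtain rfl : k = 0 := by omega
    simp
  · rw [LinearMap.smul_apply, oscA_single, smul_smul, show ((k : ℤ) + -1).toNat = k - 1 by omega]
    congr 1
    have h : exp u = exp (-u) * exp (2 * u) := by rw [← exp_add]; ring_nf
    rw [h]
    simp
    ring

theorem graded_oscAstar : Graded η α U 0 0 1 fun u => exp u • oscAstar := by
  refine ⟨_, mem_polyFns (i := 0) le_rfl 0, fun u _ k hk => by omega, fun u _ k => ?_⟩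
  rw [LinearMap.smul_apply, oscAstar_single, show ((k : ℤ) + 1).toNat = k + 1 by omega]
  simp

/-- The degree bound depends on the row alone; for `oscLinv` it depends on the column alone. In a
conjugation only the outer indices then count, not the ones summed over. -/
theorem graded_oscLmat (a b : Fin 2) :
    Graded η α U 0 (1 - a) ((a : ℕ) - (b : ℕ) : ℤ) fun u => oscLmat η u a b := by
  simp only [oscLmat_eq]
  have hp := graded_qPowD (η := η) (α := α) (U := U) 1
  have hm := graded_qPowD (η := η) (α := α) (U := U) (-1)
  have h2 := (((graded_qPowD (η := η) (α := α) (U := U) 2).smul (exp (2 * η))).exp_smul)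
  push_cast at hp hm h2
  fin_cases a <;> fin_cases b
  · simpa [smul_smul] using ((graded_one.mono (Nat.zero_le 1)).sub h2).mul hm
  · simpa using graded_oscA.neg.mul hp
  · simpa using graded_oscAstar.neg.mul hm
  · simpa using hp

theorem graded_oscLinv (a b : Fin 2) :
    Graded η α U 0 b ((a : ℕ) - (b : ℕ) : ℤ) fun u => oscLinv η u a b := by
  simp only [oscLinv]
  have hp := graded_qPowD (η := η) (α := α) (U := U) 1
  have hm := graded_qPowD (η := η) (α := α) (U := U) (-1)
  have h2 := ((graded_qPowD (η := η) (α := α) (U := U) 2).exp_smul)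
  push_cast at hp hm h2
  fin_cases a <;> fin_cases b
  · simpa using hp
  · simpa using hp.mul graded_oscA
  · simpa using hm.mul graded_oscAstar
  · simpa using hm.mul ((graded_one.mono (Nat.zero_le 1)).sub h2)

end Graded

/-! ### The monodromy matrix `𝕋_A` -/

/-- The number of down spins. -/
def downs {n : ℕ} (x : Conf n) : ℤ := ∑ j, ((x j : ℕ) : ℤ)

theorem downs_update {n : ℕ} (x : Conf n) (j : Fin n) (a : Fin 2) :
    downs (Function.update x j a) = downs x - (x j : ℕ) + (a : ℕ) := by
  have h : ∀ y : Conf n, downs y = (y j : ℕ) + ∑ i ∈ Finset.univ.erase j, ((y i : ℕ) : ℤ) :=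
    fun y => (Finset.add_sum_erase _ _ (Finset.mem_univ j)).symm
  rw [h, h x, Function.update_self, Finset.sum_congr rfl fun i hi => by
    rw [Function.update_of_ne (Finset.ne_of_mem_erase hi)]]
  ring

theorem mag_eq {n : ℕ} (x : Conf n) : mag x = n / 2 - downs x := by
  have h : ∀ j, (if x j = 0 then (1 : ℂ) else -1) = 1 - 2 * ((x j : ℕ) : ℂ) := by
    intro j
    rcases Fin.exists_fin_two.1 ⟨x j, rfl⟩ with h | h <;> rw [h] <;> norm_num
  simp only [mag, h, Finset.sum_sub_distrib, ← Finset.mul_sum, downs]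
  push_cast
  simp
  ring

/-- Induction along the chain. The new site multiplies by a row of `oscLmat` on the left and a
column of `oscLinv` on the right; the grades telescope over the intermediate spins, and the degrees
add up from the outer spins. -/
theorem graded_foldl_adj_Losc {n : ℕ} (η α : ℂ) (s : ℤ) (Z : ℂ → OpA n)
    (hZ : ∀ x y, Graded η α {u | exp (2 * u) ≠ 1} 1 0 (s + downs x - downs y) fun u => Z u x y)
    (l : List (Fin n)) (hl : l.Nodup) (x y : Conf n) :
    Graded η α {u | exp (2 * u) ≠ 1} 1 (l.map fun j => (1 - (x j : ℕ)) + (y j : ℕ)).sum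
      (s + downs x - downs y) fun u => (1 - exp (2 * u)) ^ l.length •
        (l.foldl (fun Z j => adj (Losc n η u j) Z) (Z u)) x y := by
  induction l using List.reverseRecOn generalizing x y with
  | nil => simpa using hZ x y
  | append_singleton l j ih =>
    have hj : j ∉ l := fun h => by simpa using (List.nodup_append.1 hl).2.2 j h
    have ih := ih (List.nodup_append.1 hl).1
    -- The new site does not occur in `l`, so changing its spins leaves the bound accumulated so far
    -- unchanged.
    have hupd : ∀ (x y : Conf n) (a b : Fin 2),
        (l.map fun i => (1 - (Function.update x j a i : ℕ)) + (Function.update y j b i : ℕ)) =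
        l.map fun i => (1 - (x i : ℕ)) + (y i : ℕ) := by
      intro x y a b
      refine List.map_congr_left fun i hi => ?_
      have : i ≠ j := fun h => hj (h ▸ hi)
      rw [Function.update_of_ne this, Function.update_of_ne this]
    have key : Graded η α {u | exp (2 * u) ≠ 1} 1
        ((l ++ [j]).map fun j => (1 - (x j : ℕ)) + (y j : ℕ)).sum (s + downs x - downs y)
        fun u => ∑ b : Fin 2, (∑ a : Fin 2, oscLmat η u (x j) a *
          ((1 - exp (2 * u)) ^ l.length • (l.foldl (fun Z j => adj (Losc n η u j) Z) (Z u))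
            (Function.update x j a) (Function.update y j b))) * oscLinv η u b (y j) := by
      refine Graded.sum _ fun b _ => ?_
      have h1 : Graded η α {u | exp (2 * u) ≠ 1} 1
          ((1 - (x j : ℕ)) + (l.map fun j => (1 - (x j : ℕ)) + (y j : ℕ)).sum)
          (s + downs x - (downs y - (y j : ℕ) + (b : ℕ)))
          fun u => ∑ a : Fin 2, oscLmat η u (x j) a *
          ((1 - exp (2 * u)) ^ l.length • (l.foldl (fun Z j => adj (Losc n η u j) Z) (Z u))
            (Function.update x j a) (Function.update y j b)) := by
        refine Graded.sum _ fun a _ => ?_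
        have h := (graded_oscLmat (x j) a).mul
          (ih (Function.update x j a) (Function.update y j b))
        rw [hupd, downs_update, downs_update] at h
        convert h using 1
        ring
      have h := h1.mul (graded_oscLinv b (y j))
      convert h using 1
      · simp only [List.map_append, List.sum_append, List.map_cons, List.map_nil, List.sum_cons,
          List.sum_nil]
        ring
      · ring
    refine key.congr fun u hu => ?_
    rw [List.foldl_append, List.foldl_cons, List.foldl_nil, List.length_append, List.length_singleton,
      pow_succ, mul_smul, ← Matrix.smul_apply, smul_adj_Losc hu, mul_siteOp_apply, Finset.smul_sum]
    refine Finset.sum_congr rfl fun b _ => ?_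
    rw [siteOp_mul_apply, ← smul_mul_assoc, Finset.smul_sum]
    congr 1
    refine Finset.sum_congr rfl fun a _ => ?_
    rw [mul_smul_comm]

/-! ### The monodromy matrix `𝕋_a` -/

/-- The polynomials in `ζ` of degree at most `N` that have the parity of `p`. -/
def parFns (p N : ℕ) : Submodule ℂ (ℂ → ℂ) :=
  Submodule.span ℂ {f | ∃ i ≤ N, i % 2 = p % 2 ∧ f = fun u => exp (i * u)}

theorem mem_parFns {i p N : ℕ} (hi : i ≤ N) (hp : i % 2 = p % 2) :
    (fun u => exp (i * u)) ∈ parFns p N :=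
  Submodule.subset_span ⟨i, hi, hp, rfl⟩

theorem const_mem_parFns {p N : ℕ} (hp : p % 2 = 0) (c : ℂ) : (fun _ => c) ∈ parFns p N := by
  convert Submodule.smul_mem _ c (mem_parFns (i := 0) (Nat.zero_le N) (p := p) (by simp [hp])) using 1
  funext u
  simp

theorem mul_mem_parFns {p p' N N' : ℕ} {f g : ℂ → ℂ} (hf : f ∈ parFns p N)
    (hg : g ∈ parFns p' N') : f * g ∈ parFns (p + p') (N + N') := by
  have h := Submodule.mul_mem_mul hf hg
  rw [parFns, parFns, Submodule.span_mul_span] at h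
  refine Submodule.span_mono ?_ h
  rintro _ ⟨_, ⟨i, hi, hp, rfl⟩, _, ⟨i', hi', hp', rfl⟩, rfl⟩
  refine ⟨i + i', by omega, by omega, ?_⟩
  funext u
  simp only [Pi.mul_apply, ← exp_add]
  congr 1
  push_cast; ring

theorem parFns_congr {p p' N N' : ℕ} (hp : p % 2 = p' % 2) (hN : N ≤ N') :
    parFns p N ≤ parFns p' N' :=
  Submodule.span_mono fun _ ⟨i, hi, h, hf⟩ => ⟨i, hi.trans hN, h.trans hp, hf⟩

/-- The logarithms `u` of those `ζ` where `R(ζ)` and its inverse are defined. -/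
def regularSet (η : ℂ) : Set ℂ := {u | exp (2 * u) ≠ exp (2 * η) ∧ exp (2 * u) ≠ exp (-(2 * η))}

theorem regularSet_ne_zero {η u : ℂ} (hu : u ∈ regularSet η) :
    1 - exp (2 * η) * exp (2 * u) ≠ 0 := by
  rw [sub_ne_zero]
  intro h
  apply hu.2
  rw [exp_neg]
  exact eq_inv_of_mul_eq_one_right h.symm

theorem regularSet_ne_zero' {η u : ℂ} (hu : u ∈ regularSet η) : exp (2 * η) - exp (2 * u) ≠ 0 :=
  sub_ne_zero.2 hu.1.symm

theorem exp_two_mul_mem_parFns {p : ℕ} (hp : p % 2 = 0) :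
    (fun u => exp (2 * u)) ∈ parFns p 2 := by
  simpa using mem_parFns (i := 2) le_rfl (p := p) (by omega)

theorem exp_mem_parFns {p : ℕ} (hp : p % 2 = 1) : (fun u => exp u) ∈ parFns p 2 := by
  simpa using mem_parFns (i := 1) (N := 2) (by norm_num) (p := p) (by omega)

theorem exchange_parity {p p' : Fin 2 × Fin 2} (h : p ≠ p') (h' : p.1 = p'.2 ∧ p.2 = p'.1) :
    (p.1 + p'.1 : ℕ) % 2 = 1 := by
  obtain ⟨a, b⟩ := p
  obtain ⟨c, d⟩ := p'
  obtain ⟨rfl, rfl⟩ := h'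
  fin_cases a <;> fin_cases b <;> simp at *

/-- Entries of `R` that preserve the auxiliary spin are even in `ζ`; those that flip it, namely `γ`,
are odd. -/
theorem sixVertexR_mem_parFns (η : ℂ) (p p' : Fin 2 × Fin 2) :
    ∃ g ∈ parFns (p.1 + p'.1) 2, ∀ u ∈ regularSet η,
      (1 - exp (2 * η) * exp (2 * u)) * sixVertexR η u p p' = g u := by
  simp only [sixVertexR, Matrix.of_apply]
  have hev : p = p' → (p.1 + p'.1 : ℕ) % 2 = 0 := by rintro rfl; omega
  split_ifs with h₁ h₂ h₃
  · exact ⟨_, Submodule.sub_mem _ (const_mem_parFns (hev h₁) 1)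
      (Submodule.smul_mem _ (exp (2 * η)) (exp_two_mul_mem_parFns (hev h₁))),
      fun u hu => by simp⟩
  · refine ⟨_, Submodule.smul_mem _ (exp η) (Submodule.sub_mem _ (const_mem_parFns (hev h₁) 1)
      (exp_two_mul_mem_parFns (hev h₁))), fun u hu => ?_⟩
    rw [mul_div_cancel₀ _ (regularSet_ne_zero hu)]
    simp [mul_comm]
  · refine ⟨_, Submodule.smul_mem _ (1 - exp (2 * η)) (exp_mem_parFns (exchange_parity h₁ h₃)),
      fun u hu => ?_⟩
    rw [mul_div_cancel₀ _ (regularSet_ne_zero hu)]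
    simp
  · exact ⟨0, Submodule.zero_mem _, fun u hu => by simp⟩

/-- Since `1 - q²ζ^{-2} = -ζ^{-2}(q² - ζ²)`, clearing the denominator of `R(ζ⁻¹)` releases a factor
`ζ²`, which makes the numerators polynomial and keeps their parity. -/
theorem sixVertexR_neg_mem_parFns (η : ℂ) (p p' : Fin 2 × Fin 2) :
    ∃ g ∈ parFns (p.1 + p'.1) 2, ∀ u ∈ regularSet η,
      (exp (2 * η) - exp (2 * u)) * sixVertexR η (-u) p p' = g u := by
  simp only [sixVertexR, Matrix.of_apply]
  have hev : p = p' → (p.1 + p'.1 : ℕ) % 2 = 0 := by rintro rfl; omega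
  have hd : ∀ u, exp (2 * -u) = (exp u ^ 2)⁻¹ := fun u => by
    rw [← exp_nat_mul, ← exp_neg]; congr 1; push_cast; ring
  have hsq : ∀ u, exp (2 * u) = exp u ^ 2 := fun u => by
    rw [← exp_nat_mul]; norm_num
  have key : ∀ u ∈ regularSet η, ∀ c : ℂ,
      (exp (2 * η) - exp (2 * u)) * (c / (1 - exp (2 * η) * exp (2 * -u))) =
        -(exp u ^ 2 * c) := by
    intro u hu c
    have h0 := exp_ne_zero u
    have h1 := regularSet_ne_zero' hu
    have h2 : 1 - exp (2 * η) * exp (2 * -u) = -(exp (2 * η) - exp (2 * u)) * (exp u ^ 2)⁻¹ := by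
      rw [hd, hsq u]; field_simp; ring
    rw [h2]
    field_simp
  split_ifs with h₁ h₂ h₃
  · exact ⟨_, Submodule.sub_mem _ (const_mem_parFns (hev h₁) (exp (2 * η)))
      (exp_two_mul_mem_parFns (hev h₁)), fun u hu => by simp⟩
  · refine ⟨_, Submodule.smul_mem _ (exp η) (Submodule.sub_mem _ (const_mem_parFns (hev h₁) 1)
      (exp_two_mul_mem_parFns (hev h₁))), fun u hu => ?_⟩
    have h0 := exp_ne_zero u
    rw [key u hu, hd]
    simp [hsq]
    field_simp
    ring
  · refine ⟨_, Submodule.smul_mem _ (-(1 - exp (2 * η)))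
      (exp_mem_parFns (exchange_parity h₁ h₃)), fun u hu => ?_⟩
    have h0 := exp_ne_zero u
    rw [key u hu, exp_neg]
    simp
    field_simp
    ring
  · exact ⟨0, Submodule.zero_mem _, fun u hu => by simp⟩

/-- The common denominator of the matrix elements of `𝕃_a(ζ)`. -/
def auxDenom (η u : ℂ) : ℂ := (1 - exp (2 * η) * exp (2 * u)) * (exp (2 * η) - exp (2 * u))

theorem sum_sum_comm {ι κ τ M : Type*} [Fintype ι] [Fintype κ] [Fintype τ] [AddCommMonoid M]
    (f : ι → κ → τ → M) : ∑ i, ∑ j, ∑ k, f i j k = ∑ k, ∑ i, ∑ j, f i j k :=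
  (Finset.sum_congr rfl fun _ _ => Finset.sum_comm).trans Finset.sum_comm

/-- `L_a` has scalar entries, which commute with operators on `W⁺`; hence `𝕋_a` acts on `Z` by
scalar coefficients `g` that do not depend on `Z`. Each site contributes degree `2 + 2` and one
factor `auxDenom`. -/
theorem foldl_adj_Lfund {n : ℕ} (η α : ℂ) (l : List (Fin n)) (p p' : Fin 2 × Conf n) :
    ∃ g : Conf n → Conf n → ℂ → ℂ, (∀ x y, g x y ∈ parFns (p.1 + p'.1) (4 * l.length)) ∧
      ∀ u ∈ regularSet η, ∀ Z : OpA n, auxDenom η u ^ l.length •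
        (l.foldl (fun Y j => adj (Lfund n η u j) Y) (Matrix.of fun p p' =>
          if p.1 = p'.1 then exp ((if p.1 = 0 then α else -α) * η) • Z p.2 p'.2 else 0)) p p' =
        ∑ x, ∑ y, g x y u • Z x y := by
  induction l using List.reverseRecOn generalizing p p' with
  | nil =>
    refine ⟨fun x y => if p.1 = p'.1 ∧ p.2 = x ∧ p'.2 = y then
      fun _ => exp ((if p.1 = 0 then α else -α) * η) else 0, fun x y => ?_, fun u hu Z => ?_⟩
    · by_cases h : p.1 = p'.1 ∧ p.2 = x ∧ p'.2 = y
      · simp only [if_pos h]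
        exact const_mem_parFns (by rw [h.1]; omega) _
      · simp only [if_neg h]
        exact Submodule.zero_mem _
    · by_cases h : p.1 = p'.1
      · have : ∀ x y, (if p.1 = p'.1 ∧ p.2 = x ∧ p'.2 = y then
          fun _ : ℂ => exp ((if p.1 = 0 then α else -α) * η) else 0) u • Z x y =
          if p.2 = x then (if p'.2 = y then exp ((if p.1 = 0 then α else -α) * η) • Z x y else 0)
          else 0 := by
          intro x y
          simp only [h, true_and]
          by_cases h1 : p.2 = x <;> by_cases h2 : p'.2 = y <;> simp [h1, h2]
        simp only [this]
        simp [h]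
      · simp [h]
  | append_singleton l j ih =>
    choose r hr hru using sixVertexR_mem_parFns η
    choose r' hr' hru' using sixVertexR_neg_mem_parFns η
    choose g hg hgu using ih
    refine ⟨fun x y => ∑ b : Fin 2 × Fin 2, ∑ a : Fin 2 × Fin 2, r (p.1, p.2 j) a *
      g (a.1, Function.update p.2 j a.2) (b.1, Function.update p'.2 j b.2) x y *
        r' b (p'.1, p'.2 j), fun x y => ?_, fun u hu Z => ?_⟩
    · refine Submodule.sum_mem _ fun b _ => Submodule.sum_mem _ fun a _ => ?_
      refine parFns_congr ?_ ?_ (mul_mem_parFns (mul_mem_parFns (hr _ _) (hg _ _ x y)) (hr' _ _))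
      -- The intermediate auxiliary indices occur twice each, so they drop out of the parity.
      · simp only; omega
      · simp only [List.length_append, List.length_singleton]; omega
    · rw [List.foldl_append, List.foldl_cons, List.foldl_nil, List.length_append,
        List.length_singleton, pow_succ, smul_adj_Lfund hu.1 hu.2, mul_auxSiteOp_apply]
      simp only [auxSiteOp_mul_apply, Finset.sum_apply, Pi.mul_apply, Finset.sum_smul,
        Finset.smul_sum, Finset.sum_mul]
      symm
      refine (sum_sum_comm _).trans (Finset.sum_congr rfl fun b _ => (sum_sum_comm _).trans
        (Finset.sum_congr rfl fun a _ => ?_))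
      have h := hgu (a.1, Function.update p.2 j a.2) (b.1, Function.update p'.2 j b.2) u hu Z
      rw [Matrix.map_apply, Matrix.map_apply, ← Algebra.smul_def, smul_mul_assoc,
        ← Algebra.commutes, ← Algebra.smul_def, smul_smul, smul_smul]
      have e : ∀ c : ℂ, c * auxDenom η u *
          sixVertexR η u (p.1, p.2 j) a * sixVertexR η (-u) b (p'.1, p'.2 j) =
          r (p.1, p.2 j) a u * r' b (p'.1, p'.2 j) u * c := fun c => by
        rw [auxDenom, ← hru _ _ u hu, ← hru' _ _ u hu]; ring
      rw [e, mul_smul, h, Finset.smul_sum]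
      refine Finset.sum_congr rfl fun x _ => ?_
      rw [Finset.smul_sum]
      refine Finset.sum_congr rfl fun y _ => ?_
      rw [smul_smul]
      congr 1
      ring

/-! ### The trace over `W⁺` -/

/-- `τ` is the value of `oscTrace` on `d`, with `d` in the domain where `oscTrace` is meaningful. -/
def HasTrace (η α : ℂ) (d : ℕ → ℂ) (τ : ℂ) : Prop :=
  ∃ c : ℤ →₀ ℂ, (∀ k : ℕ, d k = c.sum fun m a => a * exp ((2 * α + m) * k * η)) ∧
    τ = c.sum fun m a => a / (1 - exp ((2 * α + m) * η))

section Trace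

variable {η α : ℂ} {d d' : ℕ → ℂ} {τ τ' : ℂ}

/-- `oscTrace` depends on a chosen expansion and takes a default value elsewhere, so its linearity
is not automatic. Linearity is proved for the relation `HasTrace` and transferred through uniqueness
of the expansion. -/
theorem HasTrace.oscTrace_eq (h : HasTrace η α d τ)
    (hq : ∀ m : ℕ, m ≠ 0 → exp (m * η) ≠ 1) : oscTrace η α d = τ := by
  obtain ⟨c, hc, rfl⟩ := h
  exact XXZ.oscTrace_eq η α hq d c hc

theorem HasTrace.zero : HasTrace η α 0 0 := ⟨0, by simp, by simp⟩

theorem HasTrace.add (h : HasTrace η α d τ) (h' : HasTrace η α d' τ') :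
    HasTrace η α (d + d') (τ + τ') := by
  obtain ⟨c, hc, rfl⟩ := h
  obtain ⟨c', hc', rfl⟩ := h'
  refine ⟨c + c', fun k => ?_, ?_⟩
  · rw [Pi.add_apply, hc, hc', Finsupp.sum_add_index' (by simp) (by intros; ring)]
  · rw [Finsupp.sum_add_index' (by simp) (by intros; ring)]

theorem HasTrace.smul (h : HasTrace η α d τ) (b : ℂ) : HasTrace η α (b • d) (b * τ) := by
  obtain ⟨c, hc, rfl⟩ := h
  refine ⟨b • c, fun k => ?_, ?_⟩
  · rw [Pi.smul_apply, hc, Finsupp.sum_smul_index (by simp), Finsupp.sum, Finsupp.sum,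
      smul_eq_mul, Finset.mul_sum]
    exact Finset.sum_congr rfl fun _ _ => by ring
  · rw [Finsupp.sum_smul_index (by simp), Finsupp.sum, Finsupp.sum, Finset.mul_sum]
    exact Finset.sum_congr rfl fun _ _ => by ring

theorem HasTrace.sum {ι : Type*} (s : Finset ι) {d : ι → ℕ → ℂ} {τ : ι → ℂ}
    (h : ∀ i ∈ s, HasTrace η α (d i) (τ i)) : HasTrace η α (∑ i ∈ s, d i) (∑ i ∈ s, τ i) := by
  classical
  induction s using Finset.induction_on with
  | empty => simpa using HasTrace.zero
  | insert i s hi ih =>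
    rw [Finset.sum_insert hi, Finset.sum_insert hi]
    exact (h i (by simp)).add (ih fun j hj => h j (by simp [hj]))

/-- The polynomials in `ζ²` of degree at most `N`. -/
def sqFns (N : ℕ) : Submodule ℂ (ℂ → ℂ) :=
  Submodule.span ℂ {f | ∃ i ≤ N, f = fun u : ℂ => exp (2 * (i : ℂ) * u)}

/-- Exponent `e = 1` means that exactly one factor `q^{2αk}` is present, the form that `oscTrace`
sums. The summation acts on `k` only and preserves the degree in `ζ²`. -/
theorem exists_hasTrace {N : ℕ} {f : ℂ → ℤ → ℂ} (hf : f ∈ polyFns η α 1 N) :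
    ∃ t ∈ sqFns N, ∀ u, HasTrace η α (fun k => f u k) (t u) := by
  induction hf using Submodule.span_induction with
  | mem f hf =>
    obtain ⟨i, hi, m, rfl⟩ := hf
    refine ⟨_, Submodule.smul_mem _ (1 / (1 - exp ((2 * α + m) * η)))
      (Submodule.subset_span ⟨i, hi, rfl⟩), fun u =>
      ⟨Finsupp.single m (exp (2 * i * u)), fun k => ?_, ?_⟩⟩
    · rw [Finsupp.sum_single_index (by simp)]
      simp
    · rw [Finsupp.sum_single_index (by simp)]
      simp only [Pi.smul_apply, smul_eq_mul]
      ring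
  | zero => exact ⟨0, Submodule.zero_mem _, fun u => HasTrace.zero⟩
  | add f g _ _ hf hg =>
    obtain ⟨t, ht, htr⟩ := hf
    obtain ⟨t', ht', htr'⟩ := hg
    exact ⟨t + t', Submodule.add_mem _ ht ht', fun u => (htr u).add (htr' u)⟩
  | smul c f _ hf =>
    obtain ⟨t, ht, htr⟩ := hf
    exact ⟨c • t, Submodule.smul_mem _ c ht, fun u => (htr u).smul c⟩

theorem Graded.exists_hasTrace {U : Set ℂ} {N : ℕ} {T : ℂ → Module.End ℂ Fock}
    (h : Graded η α U 1 N 0 T) :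
    ∃ t ∈ sqFns N, ∀ u ∈ U, HasTrace η α (fun k => T u (Finsupp.single k 1) k) (t u) := by
  obtain ⟨f, hf, -, hfT⟩ := h
  obtain ⟨t, ht, htr⟩ := XXZ.exists_hasTrace hf
  refine ⟨t, ht, fun u hu => ?_⟩
  convert htr u using 2 with k
  rw [hfT u hu]
  simp

theorem Graded.diag_eq_zero {U : Set ℂ} {e N : ℕ} {m : ℤ} {T : ℂ → Module.End ℂ Fock}
    (h : Graded η α U e N m T) (hm : m ≠ 0) {u : ℂ} (hu : u ∈ U) (k : ℕ) :
    T u (Finsupp.single k 1) k = 0 := by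
  obtain ⟨f, hf, hf0, hfT⟩ := h
  rw [hfT u hu]
  by_cases hk : (k : ℤ) + m < 0
  · simp [hf0 u hu k hk]
  · rw [Finsupp.smul_apply, Finsupp.single_eq_of_ne (by omega), smul_zero]

/-- An odd polynomial of degree at most `4n` has degree at most `4n - 1 = 2(2n - 1) + 1`. The unit
gained here is what makes `k_skal` a proper fraction. -/
theorem mul_eq_sum_of_mem {n K N : ℕ} (hK : ∀ i j, i < 2 * n → j ≤ N → i + j < K) {f t : ℂ → ℂ}
    (hf : f ∈ parFns 1 (4 * n)) (ht : t ∈ sqFns N) :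
    ∃ c : ℕ → ℂ, ∀ u, f u * t u = ∑ i ∈ Finset.range K, c i * exp ((2 * i + 1) * u) := by
  have h := Submodule.mul_mem_mul hf ht
  rw [parFns, sqFns, Submodule.span_mul_span] at h
  change ∃ c : ℕ → ℂ, ∀ u, (f * t) u = _
  generalize f * t = F at h ⊢
  induction h using Submodule.span_induction with
  | mem f hf =>
    obtain ⟨_, ⟨i, hi, hp, rfl⟩, _, ⟨j, hj, rfl⟩, rfl⟩ := hf
    obtain ⟨i', rfl⟩ : ∃ i', i = 2 * i' + 1 := ⟨i / 2, by omega⟩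
    refine ⟨Pi.single (i' + j) 1, fun u => ?_⟩
    rw [Finset.sum_eq_single_of_mem (i' + j) (Finset.mem_range.2 (hK _ _ (by omega) hj))]
    · simp only [Pi.mul_apply, ← exp_add, Pi.single_eq_same, one_mul]
      congr 1
      push_cast; ring
    · intro k _ hk
      simp [hk]
  | zero => exact ⟨0, by simp⟩
  | add f g _ _ hf hg =>
    obtain ⟨c, hc⟩ := hf
    obtain ⟨c', hc'⟩ := hg
    exact ⟨c + c', fun u => by simp [hc, hc', add_mul, Finset.sum_add_distrib]⟩
  | smul b f _ hf =>
    obtain ⟨c, hc⟩ := hf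
    exact ⟨b • c, fun u => by simp [hc, Finset.mul_sum, mul_assoc]⟩

end Trace

/-! ### Matrix elements of `k(ζ,α)` -/

theorem foldl_adj_add {R ι : Type*} [Ring R] (L : ι → R) (l : List ι) (Z Z' : R) :
    l.foldl (fun Z j => adj (L j) Z) (Z + Z') =
      l.foldl (fun Z j => adj (L j) Z) Z + l.foldl (fun Z j => adj (L j) Z) Z' := by
  induction l generalizing Z Z' with
  | nil => rfl
  | cons j l ih => simp only [List.foldl_cons, adj_add, ih]

theorem foldl_adj_smul {R ι : Type*} [Ring R] [Algebra ℂ R] (L : ι → R) (l : List ι) (c : ℂ)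
    (Z : R) : l.foldl (fun Z j => adj (L j) Z) (c • Z) =
      c • l.foldl (fun Z j => adj (L j) Z) Z := by
  induction l generalizing Z with
  | nil => rfl
  | cons j l ih => simp only [List.foldl_cons, adj_smul, ih]

theorem HasSpin.eq_zero {n : ℕ} {s : ℤ} {X : Op n} (h : HasSpin s X) {x y : Conf n}
    (hxy : downs y - downs x ≠ s) : X x y = 0 := by
  have h1 := congrFun (congrFun h x) y
  simp only [spinZ, Matrix.sub_apply, Matrix.diagonal_mul, Matrix.mul_diagonal, Matrix.smul_apply,
    smul_eq_mul, mag_eq] at h1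
  have h2 : ((downs y - downs x - s : ℤ) : ℂ) * X x y = 0 := by push_cast; linear_combination h1
  rcases mul_eq_zero.1 h2 with h3 | h3
  · exact (hxy (by have := Int.cast_eq_zero.1 h3; omega)).elim
  · exact h3

theorem HasSpin.dressed_eq {n : ℕ} {s : ℤ} {X : Op n} (h : HasSpin s X) (η α u : ℂ) :
    dressed η α u X =
      exp ((α - s) * u) • Matrix.of fun x y => exp (-2 * mag x * η) * X x y := by
  ext x y
  simp only [dressed, Matrix.of_apply, Matrix.smul_apply, smul_eq_mul]
  by_cases hxy : downs y - downs x = s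
  · congr 3
    rw [mag_eq, mag_eq, ← hxy]
    push_cast; ring
  · simp [h.eq_zero hxy]

/-- The diagonal matrix elements under the trace that defines `k(ζ,α) X`. -/
def kDiag {n : ℕ} (η α u : ℂ) (X : Op n) (x y : Conf n) (m : ℕ) : ℂ :=
  monoFund n η α u (monoOsc n η α u (dressed η α u X)) (1, x) (0, y) (Finsupp.single m 1) m

/-- The trace against `σ⁺` keeps only the entry in row `1` and column `0` of `V_a`, one that flips
the auxiliary spin and so is odd in `ζ`. -/
theorem kOp_apply {n : ℕ} (η α u : ℂ) (X : Op n) (x y : Conf n) :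
    kOp η α u X x y = oscTrace η α (kDiag η α u X x y) := by
  have h : ∀ (M : OpaA n) (a : Fin 2), (sigmaPlus n * M) (a, x) (a, y) =
      if a = 0 then M (1, x) (0, y) else 0 := by
    intro M a
    rw [Matrix.mul_apply, Fintype.sum_prod_type]
    fin_cases a <;> simp [sigmaPlus]
  simp only [kOp, Matrix.of_apply, h]
  congr 1
  funext m
  simp [kDiag]

theorem kDiag_add {n : ℕ} (η α u : ℂ) (X Y : Op n) (x y : Conf n) :
    kDiag η α u (X + Y) x y = kDiag η α u X x y + kDiag η α u Y x y := by
  have h1 : dressed η α u (X + Y) = dressed η α u X + dressed η α u Y := by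
    ext x y; simp [dressed, mul_add]
  have h2 : ∀ X Y : Op n, monoOsc n η α u (X + Y) = monoOsc n η α u X + monoOsc n η α u Y := by
    intro X Y
    rw [monoOsc, monoOsc, monoOsc, ← foldl_adj_add]
    congr 1
    ext x y
    simp [add_smul]
  have h3 : ∀ X Y : OpA n, monoFund n η α u (X + Y) = monoFund n η α u X + monoFund n η α u Y := by
    intro X Y
    rw [monoFund, monoFund, monoFund, ← foldl_adj_add]
    congr 1
    ext1 p p'
    by_cases h : p.1 = p'.1 <;> simp [h]
  funext m
  simp [kDiag, h1, h2, h3]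

theorem monoOsc_smul {n : ℕ} (η α u c : ℂ) (X : Op n) :
    monoOsc n η α u (c • X) = c • monoOsc n η α u X := by
  rw [monoOsc, monoOsc, ← foldl_adj_smul]
  congr 1
  ext1 x y
  simp [smul_smul]

theorem kDiag_smul {n : ℕ} (η α u c : ℂ) (X : Op n) (x y : Conf n) :
    kDiag η α u (c • X) x y = c • kDiag η α u X x y := by
  have h1 : dressed η α u (c • X) = c • dressed η α u X := by
    ext x y; simp [dressed]; ring
  have h3 : ∀ X : OpA n, monoFund n η α u (c • X) = c • monoFund n η α u X := by
    intro X
    rw [monoFund, monoFund, ← foldl_adj_smul]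
    congr 1
    ext1 p p'
    by_cases h : p.1 = p'.1 <;> simp [h, smul_comm c]
  funext m
  simp [kDiag, h1, monoOsc_smul, h3]

/-- The logarithms `u` of those `ζ` that are not poles of `k(ζ,α)`. -/
def kDomain (η : ℂ) : Set ℂ := {u | ∀ ε ∈ Finset.Icc (-1 : ℤ) 1, exp (2 * u) ≠ exp (2 * ε * η)}

theorem kDomain_subset {η u : ℂ} (hu : u ∈ kDomain η) : exp (2 * u) ≠ 1 ∧ u ∈ regularSet η := by
  refine ⟨?_, ?_, ?_⟩
  · simpa using hu 0 (by simp)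
  · simpa using hu 1 (by simp)
  · simpa using hu (-1) (by simp)

/-- On entries of grade zero, where `downs y - downs x = s`, the degree bound becomes `n + s`. -/
theorem sum_weight {n : ℕ} (x y : Conf n) :
    ((((List.finRange n).map fun j => (1 - (x j : ℕ)) + (y j : ℕ)).sum : ℕ) : ℤ) =
      n - downs x + downs y := by
  rw [← Fin.sum_univ_def, downs, downs, Nat.cast_sum]
  have : ∀ j, (((1 - (x j : ℕ)) + (y j : ℕ) : ℕ) : ℤ) = 1 - (x j : ℕ) + (y j : ℕ) := by
    intro j; omega
  simp [this, Finset.sum_add_distrib]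

theorem graded_zeroth {n : ℕ} (η α : ℂ) (s : ℤ) {X : Op n} (hX : HasSpin s X) (x y : Conf n)
    (U : Set ℂ) :
    Graded η α U 1 0 (s + downs x - downs y) fun _ => (exp (-2 * mag x * η) * X x y) •
      qPowD η (2 * α) := by
  by_cases hxy : downs y - downs x = s
  · rw [show s + downs x - downs y = 0 by omega]
    refine Graded.smul ⟨_, mem_polyFns (i := 0) le_rfl 0, fun u _ k hk => by omega,
      fun u _ k => ?_⟩ _
    rw [qPowD_single]
    simp
  · rw [hX.eq_zero hxy]
    simpa using Graded.zero

/-- The degree count: at most `2n - 1` from `𝕋_a` and `n + s` from `𝕋_A`, hence fewer than `3n + s`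
powers of `ζ²`, besides the odd factor `ζ`. -/
theorem exists_hasTrace_kDiag {n : ℕ} (η α : ℂ) (s : ℤ) {X : Op n} (hX : HasSpin s X)
    (x y : Conf n) :
    ∃ c : ℕ → ℂ, ∀ u ∈ kDomain η, HasTrace η α (kDiag η α u X x y)
      (exp ((α - s) * u) * ((1 - exp (2 * u)) ^ n * auxDenom η u ^ n)⁻¹ *
        ∑ i ∈ Finset.range (3 * n + s).toNat, c i * exp ((2 * i + 1) * u)) := by
  obtain ⟨g, hg, hgu⟩ := foldl_adj_Lfund η α (List.finRange n) ((1, x) : Fin 2 × Conf n) (0, y)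
  have hgr := graded_foldl_adj_Losc η α s
    (fun _ => Matrix.of fun x y => (exp (-2 * mag x * η) * X x y) • qPowD η (2 * α))
    (fun x y => graded_zeroth η α s hX x y _) (List.finRange n) (List.nodup_finRange n)
  rw [List.length_finRange] at hg hgu hgr
  set Z : ℂ → OpA n := fun u => (List.finRange n).foldl (fun Z j => adj (Losc n η u j) Z)
    (Matrix.of fun x y => (exp (-2 * mag x * η) * X x y) • qPowD η (2 * α)) with hZ
  have key : ∀ x' y', ∃ c : ℕ → ℂ, ∀ u ∈ kDomain η,
      HasTrace η α (fun k => g x' y' u * ((1 - exp (2 * u)) ^ n • Z u x' y') (Finsupp.single k 1) k)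
        (∑ i ∈ Finset.range (3 * n + s).toNat, c i * exp ((2 * i + 1) * u)) := by
    intro x' y'
    by_cases hd : s + downs x' - downs y' = 0
    · have h := hgr x' y'
      rw [hd] at h
      obtain ⟨t, ht, htr⟩ := h.exists_hasTrace
      have hw := sum_weight x' y'
      obtain ⟨c, hc⟩ := mul_eq_sum_of_mem (n := n) (K := (3 * n + s).toNat)
        (fun i j hi hj => by omega) (by simpa using hg x' y') ht
      refine ⟨c, fun u hu => ?_⟩
      rw [← hc]
      exact (htr u (kDomain_subset hu).1).smul (g x' y' u)
    · refine ⟨0, fun u hu => ?_⟩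
      have : ∀ k, ((1 - exp (2 * u)) ^ n • Z u x' y') (Finsupp.single k 1) k = 0 :=
        (hgr x' y').diag_eq_zero hd (kDomain_subset hu).1
      simp only [this, mul_zero, Pi.zero_apply, zero_mul, Finset.sum_const_zero]
      exact HasTrace.zero
  choose c hc using key
  refine ⟨fun i => ∑ x', ∑ y', c x' y' i, fun u hu => ?_⟩
  have h1 := HasTrace.sum Finset.univ fun x' _ => HasTrace.sum Finset.univ fun y' _ => hc x' y' u hu
  have h2 := h1.smul (exp ((α - s) * u) * ((1 - exp (2 * u)) ^ n * auxDenom η u ^ n)⁻¹)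
  have hsum : ∑ i ∈ Finset.range (3 * n + s).toNat,
      (∑ x', ∑ y', c x' y' i) * exp ((2 * i + 1) * u) =
      ∑ x', ∑ y', ∑ i ∈ Finset.range (3 * n + s).toNat, c x' y' i * exp ((2 * i + 1) * u) := by
    simp only [Finset.sum_mul]
    rw [Finset.sum_comm]
    exact Finset.sum_congr rfl fun x' _ => Finset.sum_comm
  rw [hsum]
  convert h2 using 1
  funext m
  obtain ⟨hu1, hur⟩ := kDomain_subset hu
  have hw : (1 - exp (2 * u)) ^ n ≠ 0 := pow_ne_zero _ (sub_ne_zero.2 hu1.symm)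
  have hE : auxDenom η u ^ n ≠ 0 :=
    pow_ne_zero _ (mul_ne_zero (regularSet_ne_zero hur) (regularSet_ne_zero' hur))
  have h3 := hgu u hur (monoOsc n η α u (dressed η α u X))
  have h4 : monoOsc n η α u (dressed η α u X) = exp ((α - s) * u) • Z u := by
    rw [hX.dressed_eq, monoOsc_smul]
    rfl
  have h5 : auxDenom η u ^ n * kDiag η α u X x y m =
      ∑ x', ∑ y', g x' y' u * (exp ((α - s) * u) * (Z u x' y' (Finsupp.single m 1) m)) := by
    have := congrArg (fun T : Module.End ℂ Fock => T (Finsupp.single m 1) m) h3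
    rw [h4] at this
    simpa [kDiag, monoFund, h4, LinearMap.sum_apply, Finsupp.finsetSum_apply] using this
  rw [← mul_right_inj' hE, h5]
  simp only [Pi.smul_apply, Finset.sum_apply, smul_eq_mul, LinearMap.smul_apply,
    Finsupp.smul_apply, Finset.mul_sum]
  refine Finset.sum_congr rfl fun x' _ => Finset.sum_congr rfl fun y' _ => ?_
  generalize (1 - exp (2 * u)) ^ n = W at hw ⊢
  field_simp

/-! ### Partial fractions -/

/-- Passes from the power `j < m` of a numerator `(w - a)^j` over `(w - a)^m` to the pole order `m -
j`. -/
theorem sum_Icc_reflect {M : Type*} [AddCommMonoid M] (m : ℕ) (f : Fin m → M) (g : ℕ → M)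
    (h : ∀ j : Fin m, f j = g (m - j)) : ∑ j, f j = ∑ k ∈ Finset.Icc 1 m, g k := by
  simp only [h]
  rw [Fin.sum_univ_eq_sum_range fun j => g (m - j)]
  refine Finset.sum_nbij' (fun j => m - j) (fun k => m - k) ?_ ?_ ?_ ?_ ?_
  all_goals intro j hj; simp only [Finset.mem_range, Finset.mem_Icc] at *; try omega

open Polynomial in
theorem exists_partialFraction {ι : Type*} [DecidableEq ι] (t : Finset ι) (a : ι → ℂ)
    (ha : Set.InjOn a t) (m : ι → ℕ) (p : ℂ[X]) (hp : p.degree < ((∑ i ∈ t, m i : ℕ) : WithBot ℕ)) :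
    ∃ r : ι → ℕ → ℂ, ∀ w, (∀ i ∈ t, w ≠ a i) → p.eval w / ∏ i ∈ t, (w - a i) ^ m i =
      ∑ i ∈ t, ∑ j ∈ Finset.Icc 1 (m i), ((w - a i) ^ j)⁻¹ * r i j := by
  obtain ⟨q, r, hr, hpq⟩ := eq_quo_mul_prod_pow_add_sum_rem_mul_prod_pow (s := t) p
    (g := fun i => X - C (a i)) (fun i _ => monic_X_sub_C _)
    (fun i hi j hj hij => isCoprime_X_sub_C_of_isUnit_sub
      (sub_ne_zero.2 fun h => hij (ha hi hj h)).isUnit) m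
  have hmon : (∏ i ∈ t, (X - C (a i)) ^ m i).Monic :=
    monic_prod_of_monic _ _ fun i _ => (monic_X_sub_C _).pow _
  have hdeg : (∏ i ∈ t, (X - C (a i)) ^ m i).natDegree = ∑ i ∈ t, m i := by
    rw [natDegree_prod_of_monic _ _ fun i _ => (monic_X_sub_C _).pow _]
    simp
  -- Remainders modulo a linear polynomial are constants.
  have hC : ∀ i ∈ t, ∀ j, r i j = C ((r i j).eval 0) := fun i hi j => by
    have h := hr i hi j
    rw [degree_X_sub_C] at h
    rw [eq_C_of_degree_le_zero (Nat.WithBot.lt_one_iff_le_zero.1 h)]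
    simp
  have hT : (∑ i ∈ t, ∑ j, r i j * (X - C (a i)) ^ j.1 *
      ∏ k ∈ t.erase i, (X - C (a k)) ^ m k).degree < ((∑ i ∈ t, m i : ℕ) : WithBot ℕ) := by
    rw [← mem_degreeLT]
    refine Submodule.sum_mem _ fun i hi => Submodule.sum_mem _ fun j _ => ?_
    rw [mem_degreeLT]
    refine degree_le_natDegree.trans_lt ?_
    have h1 : (r i j).natDegree = 0 := by rw [hC i hi j, natDegree_C]
    have h2 : (∏ k ∈ t.erase i, (X - C (a k)) ^ m k).natDegree = ∑ k ∈ t.erase i, m k := by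
      rw [natDegree_prod_of_monic _ _ fun i _ => (monic_X_sub_C _).pow _]
      simp
    have h3 : ((X - C (a i)) ^ j.1).natDegree = (j : ℕ) := by
      rw [natDegree_pow, natDegree_X_sub_C, mul_one]
    have h4 := natDegree_mul_le (p := r i j * (X - C (a i)) ^ j.1)
      (q := ∏ k ∈ t.erase i, (X - C (a k)) ^ m k)
    have h5 := natDegree_mul_le (p := r i j) (q := (X - C (a i)) ^ j.1)
    have h6 := Finset.add_sum_erase t m hi
    have h7 := j.2
    exact_mod_cast (by omega : _ < ∑ i ∈ t, m i)
  -- The fraction is proper: a nonzero quotient times the monic denominator would have too large a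
  -- degree.
  have hq : q = 0 := by
    by_contra hq0
    have h1 : (q * ∏ i ∈ t, (X - C (a i)) ^ m i).degree < ((∑ i ∈ t, m i : ℕ) : WithBot ℕ) := by
      rw [← mem_degreeLT] at hp hT ⊢
      rw [hpq] at hp
      exact (Submodule.add_mem_iff_left _ hT).1 hp
    have h2 : q * ∏ i ∈ t, (X - C (a i)) ^ m i ≠ 0 := mul_ne_zero hq0 hmon.ne_zero
    rw [degree_eq_natDegree h2, natDegree_mul hq0 hmon.ne_zero, hdeg] at h1
    have : q.natDegree + ∑ i ∈ t, m i < ∑ i ∈ t, m i := by exact_mod_cast h1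
    omega
  rw [hq, zero_mul, zero_add] at hpq
  refine ⟨fun i k => if h : m i - k < m i then (r i ⟨m i - k, h⟩).eval 0 else 0, fun w hw => ?_⟩
  have hprod : ∏ i ∈ t, (w - a i) ^ m i ≠ 0 :=
    Finset.prod_ne_zero_iff.2 fun i hi => pow_ne_zero _ (sub_ne_zero.2 (hw i hi))
  rw [hpq, eval_finsetSum, Finset.sum_div]
  refine Finset.sum_congr rfl fun i hi => ?_
  rw [eval_finsetSum, Finset.sum_div]
  refine sum_Icc_reflect _ _ _ fun j => ?_
  have hj : m i - (m i - j.1) = j.1 := by omega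
  simp only [hj, j.2, dif_pos]
  have h2 := Finset.mul_prod_erase t (fun i => (w - a i) ^ m i) hi
  have h3 : (w - a i) ^ m i = (w - a i) ^ (m i - j.1) * (w - a i) ^ j.1 := by
    rw [← pow_add]; congr 1; omega
  have h4 : (w - a i) ≠ 0 := sub_ne_zero.2 (hw i hi)
  have h5 : ∏ k ∈ t.erase i, (w - a k) ^ m k ≠ 0 :=
    Finset.prod_ne_zero_iff.2 fun k hk =>
      pow_ne_zero _ (sub_ne_zero.2 (hw k (Finset.mem_of_mem_erase hk)))
  rw [← h2, h3, hC i hi j]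
  simp only [eval_mul, eval_C, eval_pow, eval_sub, eval_X, eval_prod]
  field_simp

theorem kSkal_apply {n : ℕ} {η α : ℂ} (hq : ∀ m : ℕ, m ≠ 0 → exp (m * η) ≠ 1) {s : ℤ} {X : Op n}
    (hX : HasSpin s X) (x y : Conf n) :
    ∃ c : ℕ → ℂ, ∀ u ∈ kDomain η, kSkal η α s u X x y =
      (∑ i ∈ Finset.range (3 * n + s).toNat, c i * exp (2 * (i - s) * u)) /
        ∏ ε ∈ Finset.Icc (-1 : ℤ) 1, (exp (2 * u) - exp (2 * ε * η)) ^ n := by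
  obtain ⟨c, hc⟩ := exists_hasTrace_kDiag η α s hX x y
  refine ⟨fun i => (-exp (2 * η))⁻¹ ^ n * c i, fun u hu => ?_⟩
  have hI : Finset.Icc (-1 : ℤ) 1 = {-1, 0, 1} := by decide
  -- The constant comes from `(1 - w)(1 - q²w)(q² - w) = -q² (w - q^{-2})(w - 1)(w - q²)`.
  have hD : (1 - exp (2 * u)) ^ n * auxDenom η u ^ n = (-exp (2 * η)) ^ n *
      ∏ ε ∈ Finset.Icc (-1 : ℤ) 1, (exp (2 * u) - exp (2 * ε * η)) ^ n := by
    have h : exp (2 * η) * exp (2 * -1 * η) = 1 := by rw [← exp_add]; ring_nf; simp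
    rw [hI, Finset.prod_insert (by decide), Finset.prod_insert (by decide), Finset.prod_singleton,
      ← mul_pow, ← mul_pow, ← mul_pow, ← mul_pow]
    congr 1
    push_cast
    rw [auxDenom, mul_zero, zero_mul, exp_zero, mul_one]
    linear_combination (-(exp (2 * u) - 1) * (exp (2 * u) - exp (2 * η))) * h
  rw [kSkal, Matrix.smul_apply, kOp_apply, (hc u hu).oscTrace_eq hq, hD, mul_inv, smul_eq_mul,
    Finset.mul_sum, Finset.mul_sum, Finset.sum_div]
  refine Finset.sum_congr rfl fun i _ => ?_
  have h : exp (2 * (i - s) * u) =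
      exp (-(α + s + 1) * u) * exp ((α - s) * u) * exp ((2 * i + 1) * u) := by
    rw [← exp_add, ← exp_add]; congr 1; ring
  rw [h, inv_pow]
  ring

theorem exp_mul_intCast_injective {η : ℂ} (hq : ∀ m : ℕ, m ≠ 0 → exp (m * η) ≠ 1) {a b : ℤ}
    (h : exp (2 * a * η) = exp (2 * b * η)) : a = b := by
  have key : ∀ a b : ℤ, a < b → exp (2 * a * η) ≠ exp (2 * b * η) := by
    intro a b hab he
    obtain ⟨k, hk⟩ := Int.eq_ofNat_of_zero_le (sub_nonneg.mpr hab.le)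
    apply hq (2 * k) (by omega)
    have e : ((2 * k : ℕ) : ℂ) * η = 2 * b * η - 2 * a * η := by
      have : ((b - a : ℤ) : ℂ) = ((k : ℤ) : ℂ) := by rw [hk]
      push_cast at this ⊢
      rw [← this]; ring
    rw [e, exp_sub, he, div_self (exp_ne_zero _)]
  rcases lt_trichotomy a b with h1 | h1 | h1
  · exact (key _ _ h1 h).elim
  · exact h1
  · exact (key _ _ h1 h.symm).elim

open Polynomial in
theorem exists_partialFraction_kSkal_apply {n : ℕ} {η α : ℂ}
    (hq : ∀ m : ℕ, m ≠ 0 → exp (m * η) ≠ 1) {s : ℤ} {X : Op n}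
    (hX : HasSpin s X) (x y : Conf n) :
    ∃ (r : ℤ → ℕ → ℂ) (k : ℕ → ℂ), ∀ u ∈ kDomain η, kSkal η α s u X x y =
      ∑ j ∈ Finset.Icc 1 n, ∑ ε ∈ Finset.Icc (-1 : ℤ) 1,
        ((exp (2 * u) - exp (2 * ε * η)) ^ j)⁻¹ * r ε j
      + ∑ j ∈ Finset.Icc 1 s.toNat, (exp (2 * u) ^ j)⁻¹ * k j := by
  obtain ⟨c, hc⟩ := kSkal_apply (α := α) hq hX x y
  -- The label `2`, unused by `ε = 0, ±1`, stands for the extra pole at `w = 0`, of order `s.toNat`.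
  have h2 : (2 : ℤ) ∉ Finset.Icc (-1 : ℤ) 1 := by decide
  have hne : ∀ ε ∈ Finset.Icc (-1 : ℤ) 1, ε ≠ 2 := fun ε hε h => h2 (h ▸ hε)
  -- The numerator times `w^{s.toNat}`: the exponent is `i` if `s ≥ 0` and `i - s` if `s < 0`, never
  -- negative.
  set p : ℂ[X] := ∑ i ∈ Finset.range (3 * n + s).toNat,
    C (c i) * Polynomial.X ^ ((i : ℤ) - s + s.toNat).toNat with hpdef
  have hcard : ∑ i ∈ insert (2 : ℤ) (Finset.Icc (-1 : ℤ) 1), (if i = 2 then s.toNat else n) =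
      s.toNat + 3 * n := by
    rw [Finset.sum_insert h2, if_pos rfl, Finset.sum_congr rfl fun ε hε => if_neg (hne ε hε)]
    simp
  obtain ⟨r, hr⟩ := exists_partialFraction (insert (2 : ℤ) (Finset.Icc (-1 : ℤ) 1))
    (fun i => if i = 2 then 0 else exp (2 * i * η)) (by
      intro a _ b _ hab
      simp only at hab
      split_ifs at hab with h1 h3 h3
      · rw [h1, h3]
      · exact (exp_ne_zero _ hab.symm).elim
      · exact (exp_ne_zero _ hab).elim
      · exact exp_mul_intCast_injective hq hab)
    (fun i => if i = 2 then s.toNat else n) p (by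
      rw [hcard, ← mem_degreeLT]
      refine Submodule.sum_mem _ fun i hi => ?_
      rw [mem_degreeLT]
      refine (degree_C_mul_X_pow_le _ _).trans_lt ?_
      have := Finset.mem_range.1 hi
      exact_mod_cast (by omega : ((i : ℤ) - s + s.toNat).toNat < s.toNat + 3 * n))
  refine ⟨r, r 2, fun u hu => ?_⟩
  have hw := exp_ne_zero (2 * u)
  have h := hr (exp (2 * u)) (by
    intro i hi
    by_cases h : i = 2
    · rw [if_pos h]; exact hw
    · rw [if_neg h]; exact hu i ((Finset.mem_insert.1 hi).resolve_left h))
  rw [Finset.sum_insert h2, Finset.prod_insert h2, if_pos rfl, if_pos rfl, sub_zero] at h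
  have h3 : ∏ i ∈ Finset.Icc (-1 : ℤ) 1, (exp (2 * u) - if i = 2 then 0 else exp (2 * i * η)) ^
      (if i = 2 then s.toNat else n) =
      ∏ ε ∈ Finset.Icc (-1 : ℤ) 1, (exp (2 * u) - exp (2 * ε * η)) ^ n :=
    Finset.prod_congr rfl fun ε hε => by rw [if_neg (hne ε hε), if_neg (hne ε hε)]
  have h4 : ∑ i ∈ Finset.Icc (-1 : ℤ) 1, ∑ j ∈ Finset.Icc 1 (if i = 2 then s.toNat else n),
      ((exp (2 * u) - if i = 2 then 0 else exp (2 * i * η)) ^ j)⁻¹ * r i j =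
      ∑ ε ∈ Finset.Icc (-1 : ℤ) 1, ∑ j ∈ Finset.Icc 1 n,
        ((exp (2 * u) - exp (2 * ε * η)) ^ j)⁻¹ * r ε j :=
    Finset.sum_congr rfl fun ε hε => by rw [if_neg (hne ε hε), if_neg (hne ε hε)]
  rw [h3, h4] at h
  rw [hc u hu, Finset.sum_comm]
  refine Eq.trans ?_ (h.trans (add_comm _ _))
  rw [← div_div]
  congr 1
  rw [eq_div_iff (pow_ne_zero _ hw), hpdef, eval_finsetSum, Finset.sum_mul]
  refine Finset.sum_congr rfl fun i _ => ?_
  rw [eval_mul, eval_C, eval_pow, eval_X, mul_assoc, ← exp_nat_mul, ← exp_nat_mul, ← exp_add]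
  congr 2
  have h5 : ((((i : ℤ) - s + s.toNat).toNat : ℕ) : ℂ) = i - s + s.toNat := by
    have : ((((i : ℤ) - s + s.toNat).toNat : ℕ) : ℤ) = (i : ℤ) - s + s.toNat := by omega
    exact_mod_cast this
  rw [h5]
  ring

/-! ### Linearity in `X` and linear choice of the coefficients -/

theorem kOp_add {n : ℕ} {η α : ℂ} (hq : ∀ m : ℕ, m ≠ 0 → exp (m * η) ≠ 1) {s : ℤ} {X Y : Op n}
    (hX : HasSpin s X) (hY : HasSpin s Y) {u : ℂ} (hu : u ∈ kDomain η) :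
    kOp η α u (X + Y) = kOp η α u X + kOp η α u Y := by
  ext x y
  obtain ⟨c, hc⟩ := exists_hasTrace_kDiag η α s hX x y
  obtain ⟨d, hd⟩ := exists_hasTrace_kDiag η α s hY x y
  rw [Matrix.add_apply, kOp_apply, kOp_apply, kOp_apply, kDiag_add,
    ((hc u hu).add (hd u hu)).oscTrace_eq hq, (hc u hu).oscTrace_eq hq, (hd u hu).oscTrace_eq hq]

theorem kOp_smul {n : ℕ} {η α : ℂ} (hq : ∀ m : ℕ, m ≠ 0 → exp (m * η) ≠ 1) {s : ℤ} {X : Op n}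
    (hX : HasSpin s X) (c : ℂ) {u : ℂ} (hu : u ∈ kDomain η) :
    kOp η α u (c • X) = c • kOp η α u X := by
  ext x y
  obtain ⟨b, hb⟩ := exists_hasTrace_kDiag η α s hX x y
  rw [Matrix.smul_apply, kOp_apply, kOp_apply, kDiag_smul, ((hb u hu).smul c).oscTrace_eq hq,
    (hb u hu).oscTrace_eq hq, smul_eq_mul]

/-- The operators of spin `s`. -/
def spinSubmodule (n : ℕ) (s : ℤ) : Submodule ℂ (Op n) where
  carrier := {X | HasSpin s X}
  add_mem' {X Y} hX hY := by
    simp only [Set.mem_ofPred_eq, HasSpin] at *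
    rw [mul_add, add_mul, smul_add, ← hX, ← hY]
    abel
  zero_mem' := by simp [HasSpin]
  smul_mem' c X hX := by
    simp only [Set.mem_ofPred_eq, HasSpin] at *
    rw [mul_smul_comm, smul_mul_assoc, ← smul_sub, hX, smul_comm]

/-- The function of `ζ` with given coefficients of its partial fraction decomposition. -/
def partialFractionMap (n : ℕ) (η : ℂ) (s : ℤ) :
    (ℤ → ℕ → Op n) × (ℕ → Op n) →ₗ[ℂ] kDomain η → Op n where
  toFun c u := ∑ j ∈ Finset.Icc 1 n, ∑ ε ∈ Finset.Icc (-1 : ℤ) 1,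
        ((exp (2 * u) - exp (2 * ε * η)) ^ j)⁻¹ • c.1 ε j
      + ∑ j ∈ Finset.Icc 1 s.toNat, (exp (2 * (u : ℂ)) ^ j)⁻¹ • c.2 j
  map_add' c d := by
    funext u
    simp only [Prod.fst_add, Prod.snd_add, Pi.add_apply, smul_add, Finset.sum_add_distrib]
    abel
  map_smul' b c := by
    funext u
    simp only [Prod.smul_fst, Prod.smul_snd, Pi.smul_apply, smul_comm _ b, ← Finset.smul_sum,
      RingHom.id_apply, ← smul_add]

/-- Uniqueness of the coefficients is not needed to make them linear in `X`: a linear map into the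
range of `partialFractionMap` lifts, vector spaces being projective, and the lift extends from spin
`s` to all of `End H`. -/
theorem exists_isPartialFraction {n : ℕ} {η α : ℂ} (hq : ∀ m : ℕ, m ≠ 0 → exp (m * η) ≠ 1)
    (s : ℤ) : ∃ (ρ : ℤ → ℕ → Op n →ₗ[ℂ] Op n) (κ : ℕ → Op n →ₗ[ℂ] Op n),
      IsPartialFraction η α s ρ κ := by
  let K : spinSubmodule n s →ₗ[ℂ] kDomain η → Op n :=
    { toFun := fun X u => kSkal η α s u X
      map_add' := fun X Y => by
        funext u
        simp [kSkal, kOp_add hq X.2 Y.2 u.2]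
      map_smul' := fun c X => by
        funext u
        simp [kSkal, kOp_smul hq X.2 c u.2, smul_comm c] }
  have hK : ∀ X, K X ∈ LinearMap.range (partialFractionMap n η s) := by
    intro X
    choose r k h using fun x y => exists_partialFraction_kSkal_apply (α := α) hq X.2 x y
    refine ⟨(fun ε j => Matrix.of fun x y => r x y ε j, fun j => Matrix.of fun x y => k x y j), ?_⟩
    funext u
    ext x y
    change _ = kSkal η α s u X x y
    rw [h x y u u.2]
    simp [partialFractionMap, Matrix.add_apply, Matrix.sum_apply]
  obtain ⟨g, hg⟩ := Module.projective_lifting_property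
    (partialFractionMap n η s).rangeRestrict (K.codRestrict _ hK)
    (partialFractionMap n η s).surjective_rangeRestrict
  obtain ⟨f, hf⟩ := LinearMap.exists_extend g
  refine ⟨fun ε j => LinearMap.proj j ∘ₗ LinearMap.proj ε ∘ₗ LinearMap.fst ℂ _ _ ∘ₗ f,
    fun j => LinearMap.proj j ∘ₗ LinearMap.snd ℂ _ _ ∘ₗ f, fun X hX u hu => ?_⟩
  have h1 : f X = g ⟨X, hX⟩ := by rw [← hf]; rfl
  have h2 := congrArg Subtype.val (LinearMap.congr_fun hg ⟨X, hX⟩)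
  have h3 := congrFun h2 ⟨u, hu⟩
  change partialFractionMap n η s (g ⟨X, hX⟩) ⟨u, hu⟩ = kSkal η α s u X at h3
  rw [← h3, ← h1]
  rfl

/-! ### Contour integrals around `ξ² = 1` -/

open Metric in
-- From `z - 1 = (z - w) + (w - 1)` the pole order drops by one at the price of a factor `(z -
-- 1)⁻¹`. Of the pure powers split off, only `(w - 1)⁻¹` has a nonzero integral.
theorem circleIntegral_sub_inv_mul_pow_inv {r : ℝ} (hr : 0 < r) {z : ℂ} (hz : r < ‖z - 1‖) (j : ℕ) :
    ∮ w in C(1, r), (z - w)⁻¹ * ((w - 1) ^ (j + 1))⁻¹ =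
      2 * Real.pi * I * ((z - 1) ^ (j + 1))⁻¹ := by
  have hz1 : z - 1 ≠ 0 := by
    intro h; rw [h, norm_zero] at hz; exact hr.not_gt hz
  have hzw : ∀ w ∈ closedBall (1 : ℂ) r, z - w ≠ 0 := by
    intro w hw h
    rw [sub_eq_zero] at h
    subst h
    rw [mem_closedBall, dist_eq_norm] at hw
    exact hw.not_gt hz
  have hw1 : ∀ w ∈ sphere (1 : ℂ) r, w - 1 ≠ 0 := by
    intro w hw h
    rw [mem_sphere, dist_eq_norm, h, norm_zero] at hw
    exact hr.ne hw
  have hcont : ∀ j : ℕ, ContinuousOn (fun w : ℂ => ((w - 1) ^ j)⁻¹) (sphere 1 r) := fun j =>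
    ContinuousOn.inv₀ (by fun_prop) fun w hw => pow_ne_zero _ (hw1 w hw)
  have hcont' : ContinuousOn (fun w : ℂ => (z - w)⁻¹) (sphere 1 r) :=
    ContinuousOn.inv₀ (by fun_prop) fun w hw => hzw w (sphere_subset_closedBall hw)
  have step : ∀ j : ℕ, ∮ w in C(1, r), (z - w)⁻¹ * ((w - 1) ^ (j + 1))⁻¹ =
      (z - 1)⁻¹ * ((∮ w in C(1, r), ((w - 1) ^ (j + 1))⁻¹) +
        ∮ w in C(1, r), (z - w)⁻¹ * ((w - 1) ^ j)⁻¹) := by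
    intro j
    have hp : CircleIntegrable (fun w => (z - w)⁻¹ * ((w - 1) ^ j)⁻¹) 1 r :=
      (hcont'.mul (hcont j)).circleIntegrable hr.le
    rw [← circleIntegral.integral_add ((hcont _).circleIntegrable hr.le) hp, ← circleIntegral.integral_const_mul]
    refine circleIntegral.integral_congr hr.le fun w hw => ?_
    have h1 := hw1 w hw
    have h2 := hzw w (sphere_subset_closedBall hw)
    rw [pow_succ]
    field_simp
    ring
  have h0 : ∮ w in C(1, r), (z - w)⁻¹ * ((w - 1) ^ 0)⁻¹ = 0 := by
    refine DiffContOnCl.circleIntegral_eq_zero hr.le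
      (DifferentiableOn.diffContOnCl_ball (U := closedBall 1 r) ?_ subset_rfl)
    simp only [pow_zero, inv_one, mul_one]
    exact DifferentiableOn.inv (by fun_prop) hzw
  induction j with
  | zero =>
    rw [step, h0, zero_add, pow_one, add_zero]
    simp only [pow_one]
    rw [circleIntegral.integral_sub_center_inv 1 hr.ne']
    ring
  | succ j ih =>
    have h1 : ∮ w in C(1, r), ((w - 1) ^ (j + 1 + 1))⁻¹ = 0 := by
      have h := circleIntegral.integral_sub_zpow_of_ne (n := -(j + 1 + 1 : ℕ)) (by omega) 1 1 r
      simpa only [zpow_neg, zpow_natCast] using h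
    rw [step, h1, ih, zero_add, pow_succ (z - 1) (j + 1), mul_inv]
    ring

open Metric in
-- Both `z` and `0` lie outside the circle. The holomorphic part integrates to zero, and the
-- principal part `P` gives `P(z) - P(0)/2`, with `-(-1)^{-j} = (-1)^{j-1}`.
theorem circleIntegral_kernel_mul {r : ℝ} (hr : 0 < r) (hr1 : r < 1) {z : ℂ} (hz : r < ‖z - 1‖)
    (n : ℕ) (a : ℕ → ℂ) {G : ℂ → ℂ} (hG : DifferentiableOn ℂ G (closedBall 1 r)) :
    ∮ w in C(1, r), ((z - w)⁻¹ - 1 / 2 * (0 - w)⁻¹) *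
        (∑ j ∈ Finset.Icc 1 n, ((w - 1) ^ j)⁻¹ * a j + G w) =
      2 * Real.pi * I *
        ∑ j ∈ Finset.Icc 1 n, (((z - 1) ^ j)⁻¹ + 1 / 2 * (-1) ^ (j - 1)) * a j := by
  have hball : ∀ z : ℂ, r < ‖z - 1‖ → ∀ w ∈ closedBall (1 : ℂ) r, z - w ≠ 0 := by
    intro z hz w hw h
    rw [sub_eq_zero] at h
    subst h
    rw [mem_closedBall, dist_eq_norm] at hw
    exact hw.not_gt hz
  have h0 : r < ‖(0 : ℂ) - 1‖ := by simpa using hr1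
  have hw1 : ∀ w ∈ sphere (1 : ℂ) r, w - 1 ≠ 0 := by
    intro w hw h
    rw [mem_sphere, dist_eq_norm, h, norm_zero] at hw
    exact hr.ne hw
  have hk : ∀ z : ℂ, r < ‖z - 1‖ → DifferentiableOn ℂ (fun w => (z - w)⁻¹) (closedBall 1 r) :=
    fun z hz => DifferentiableOn.inv (by fun_prop) (hball z hz)
  have hkG : DifferentiableOn ℂ (fun w => ((z - w)⁻¹ - 1 / 2 * (0 - w)⁻¹) * G w)
      (closedBall 1 r) := ((hk z hz).sub ((hk 0 h0).const_mul _)).mul hG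
  have hp : ∀ z : ℂ, r < ‖z - 1‖ → ∀ (c : ℂ) (j : ℕ),
      CircleIntegrable (fun w => c * ((z - w)⁻¹ * ((w - 1) ^ j)⁻¹)) 1 r := fun z hz c j =>
    (continuousOn_const.mul (((hk z hz).continuousOn.mono sphere_subset_closedBall).mul
      (ContinuousOn.inv₀ (by fun_prop) fun w hw => pow_ne_zero _ (hw1 w hw)))).circleIntegrable
      hr.le
  have e : ∀ w, ((z - w)⁻¹ - 1 / 2 * (0 - w)⁻¹) *
      (∑ j ∈ Finset.Icc 1 n, ((w - 1) ^ j)⁻¹ * a j + G w) =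
      ∑ j ∈ Finset.Icc 1 n, (a j * ((z - w)⁻¹ * ((w - 1) ^ j)⁻¹) -
        a j / 2 * ((0 - w)⁻¹ * ((w - 1) ^ j)⁻¹)) +
      ((z - w)⁻¹ - 1 / 2 * (0 - w)⁻¹) * G w := by
    intro w
    rw [mul_add, Finset.mul_sum]
    congr 1
    refine Finset.sum_congr rfl fun j _ => ?_
    ring
  have hint : ∀ j, CircleIntegrable (fun w => a j * ((z - w)⁻¹ * ((w - 1) ^ j)⁻¹) -
        a j / 2 * ((0 - w)⁻¹ * ((w - 1) ^ j)⁻¹)) 1 r := fun j =>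
    (hp z hz (a j) j).sub (hp 0 h0 (a j / 2) j)
  simp only [e]
  rw [circleIntegral.integral_add (CircleIntegrable.fun_sum _ fun j _ => hint j)
    ((hkG.continuousOn.mono sphere_subset_closedBall).circleIntegrable hr.le),
    circleIntegral.integral_fun_sum fun j _ => hint j,
    DiffContOnCl.circleIntegral_eq_zero hr.le
      (DifferentiableOn.diffContOnCl_ball (U := closedBall 1 r) hkG subset_rfl),
    add_zero, Finset.mul_sum]
  refine Finset.sum_congr rfl fun j hj => ?_
  obtain ⟨i, rfl⟩ : ∃ i, j = i + 1 := ⟨j - 1, by have := (Finset.mem_Icc.1 hj).1; omega⟩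
  rw [circleIntegral.integral_sub (hp z hz _ _) (hp 0 h0 _ _),
    circleIntegral.integral_const_mul, circleIntegral.integral_const_mul,
    circleIntegral_sub_inv_mul_pow_inv hr hz, circleIntegral_sub_inv_mul_pow_inv hr h0,
    Nat.add_sub_cancel, zero_sub, ← inv_pow, ← inv_pow, inv_neg_one, pow_succ (-1 : ℂ)]
  ring

/-- On the circle of radius `r` around `w = 1`, with `w = ξ²`, `ξ^{-A} F(ξ)` is
`∑_j (w-1)^{-j} a_j` up to a holomorphic function. -/
def HasPolarPart {n : ℕ} (A : ℂ) (r : ℝ) (F : ℂ → Op n) (a : ℕ → Op n) : Prop :=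
  ∃ G : ℂ → Op n, (∀ x y, DifferentiableOn ℂ (fun w => G w x y) (Metric.closedBall 1 r)) ∧
    ∀ w ∈ Metric.sphere (1 : ℂ) r, F (log w / 2) =
      exp (A * (log w / 2)) • (∑ j ∈ Finset.Icc 1 n, ((w - 1) ^ j)⁻¹ • a j + G w)

theorem HasPolarPart.add {n : ℕ} {A : ℂ} {r : ℝ} {F F' : ℂ → Op n} {a a' : ℕ → Op n}
    (h : HasPolarPart A r F a) (h' : HasPolarPart A r F' a') :
    HasPolarPart A r (fun v => F v + F' v) fun j => a j + a' j := by
  obtain ⟨G, hG, hF⟩ := h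
  obtain ⟨G', hG', hF'⟩ := h'
  refine ⟨fun w => G w + G' w, fun x y => (hG x y).add (hG' x y), fun w hw => ?_⟩
  beta_reduce
  rw [hF w hw, hF' w hw, ← smul_add]
  simp only [smul_add, Finset.sum_add_distrib]
  abel

theorem HasPolarPart.neg {n : ℕ} {A : ℂ} {r : ℝ} {F : ℂ → Op n} {a : ℕ → Op n}
    (h : HasPolarPart A r F a) : HasPolarPart A r (fun v => -F v) fun j => -a j := by
  obtain ⟨G, hG, hF⟩ := h
  refine ⟨fun w => -G w, fun x y => (hG x y).neg, fun w hw => ?_⟩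
  beta_reduce
  rw [hF w hw]
  simp only [smul_neg, Finset.sum_neg_distrib, ← neg_add]

theorem HasPolarPart.contourInt_eq {n : ℕ} {η α u : ℂ} {s : ℤ} {r : ℝ} (hu : SmallCircle η u r)
    {F : ℂ → Op n} {a : ℕ → Op n} (h : HasPolarPart (α + s + 1) r F a) :
    contourInt α s r u F = exp ((α + s + 1) * u) •
      ∑ j ∈ Finset.Icc 1 n, (((exp (2 * u) - 1) ^ j)⁻¹ + 1 / 2 * (-1) ^ (j - 1)) • a j := by
  obtain ⟨G, hG, hF⟩ := h
  obtain ⟨hr, hr1, hz, -⟩ := hu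
  ext x y
  rw [contourInt, Matrix.of_apply]
  have key : ∀ w ∈ Metric.sphere (1 : ℂ) r,
      w⁻¹ * psi (u - log w / 2) (α + s + 1) * F (log w / 2) x y =
      exp ((α + s + 1) * u) * (((exp (2 * u) - w)⁻¹ - 1 / 2 * (0 - w)⁻¹) *
        (∑ j ∈ Finset.Icc 1 n, ((w - 1) ^ j)⁻¹ * a j x y + G w x y)) := by
    intro w hw
    rw [hF w hw]
    rw [Metric.mem_sphere, dist_eq_norm] at hw
    have hw0 : w ≠ 0 := by
      rintro rfl
      simp at hw; linarith
    have hzw : exp (2 * u) - w ≠ 0 := by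
      intro h
      rw [sub_eq_zero] at h
      rw [h, hw] at hz
      exact lt_irrefl _ hz
    have e1 : exp (2 * (u - log w / 2)) = exp (2 * u) / w := by
      rw [show 2 * (u - log w / 2) = 2 * u - log w by ring, exp_sub, exp_log hw0]
    -- The power of `ξ` in `ψ(ζ/ξ)` cancels the one in `F`, so the branch of `log w` plays no role.
    have e2 : exp ((α + s + 1) * (u - log w / 2)) * exp ((α + s + 1) * (log w / 2)) =
        exp ((α + s + 1) * u) := by rw [← exp_add]; ring_nf
    have e3 : w⁻¹ * ((exp (2 * u) / w + 1) / (2 * (exp (2 * u) / w - 1))) =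
        (exp (2 * u) - w)⁻¹ - 1 / 2 * (0 - w)⁻¹ := by
      have : exp (2 * u) / w - 1 = (exp (2 * u) - w) / w := by field_simp
      rw [this]
      generalize exp (2 * u) = z at hzw ⊢
      rw [zero_sub]
      field_simp
      try ring
    simp only [psi, e1, Matrix.smul_apply, Matrix.add_apply, Matrix.sum_apply, smul_eq_mul]
    rw [← e2, ← e3]
    ring
  rw [circleIntegral.integral_congr hr.le key, circleIntegral.integral_const_mul,
    circleIntegral_kernel_mul hr hr1 hz n (fun j => a j x y) (hG x y)]
  have hpi := two_pi_I_ne_zero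
  simp only [Matrix.smul_apply, Matrix.sum_apply, smul_eq_mul]
  field_simp

theorem sum_withZeroth {n : ℕ} (a : ℕ → Op n →ₗ[ℂ] Op n) (X : Op n) (z : ℂ) :
    ∑ j ∈ Finset.range (n + 1), ((z - 1) ^ j)⁻¹ • withZeroth a j X =
      ∑ j ∈ Finset.Icc 1 n, (((z - 1) ^ j)⁻¹ + 1 / 2 * (-1) ^ (j - 1)) • a j X := by
  rw [Finset.range_eq_Ico, Finset.sum_eq_sum_Ico_succ_bot (Nat.succ_pos n)]
  have h : Finset.Ico (0 + 1) (n + 1) = Finset.Icc 1 n := by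
    ext; simp only [Finset.mem_Ico, Finset.mem_Icc]; omega
  rw [h]
  simp only [add_smul, Finset.sum_add_distrib]
  rw [add_comm]
  congr 1
  · refine Finset.sum_congr rfl fun j hj => ?_
    have := (Finset.mem_Icc.1 hj).1
    rw [withZeroth, if_neg (by omega)]
  · simp [withZeroth, Finset.smul_sum, mul_smul, LinearMap.sum_apply]

theorem kOp_eq {n : ℕ} (η α : ℂ) (s : ℤ) (u : ℂ) (X : Op n) :
    kOp η α u X = exp ((α + s + 1) * u) • kSkal η α s u X := by
  rw [kSkal, smul_smul, ← exp_add, neg_mul, add_neg_cancel, exp_zero, one_smul]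

theorem exp_shift (u η : ℂ) (e : ℤ) : exp (2 * (u + e * η)) = exp (2 * u) * exp (2 * e * η) := by
  rw [← exp_add]; ring_nf

/-- The shift replaces `ξ²` by `q^{2e} w`, which moves the pole `q^{2e}` to `w = 1`; the factor is
`q^{(α+s+1)e}` from the prefactor and `q^{-2ej}` from `(q^{2e}(w - 1))^{-j}`. The other poles sit at
`0` and at `q^{2(ε-e)}` with `0 < |ε - e| ≤ 2`, outside the circle. -/
theorem hasPolarPart_kOp {n : ℕ} {η α u : ℂ} {s : ℤ} {ρ : ℤ → ℕ → Op n →ₗ[ℂ] Op n}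
    {κ : ℕ → Op n →ₗ[ℂ] Op n} (h : IsPartialFraction η α s ρ κ) {X : Op n} (hX : HasSpin s X)
    {r : ℝ} (hu : SmallCircle η u r) {e : ℤ} (he : e ∈ Finset.Icc (-1 : ℤ) 1) :
    HasPolarPart (α + s + 1) r (fun v => kOp η α (v + e * η) X)
      fun j => exp ((α + s + 1 - 2 * j) * e * η) • ρ e j X := by
  obtain ⟨hr, hr1, -, hq⟩ := hu
  have hne : ∀ ε ∈ (Finset.Icc (-1 : ℤ) 1).erase e, ∀ w ∈ Metric.closedBall (1 : ℂ) r,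
      w * exp (2 * e * η) - exp (2 * ε * η) ≠ 0 := by
    intro ε hε w hw h0
    rw [Finset.mem_erase, Finset.mem_Icc] at hε
    rw [Finset.mem_Icc] at he
    have h1 := hq (ε - e) (Finset.mem_Icc.2 ⟨by omega, by omega⟩) (by omega)
    have h2 : w = exp (2 * (ε - e : ℤ) * η) := by
      have h3 : exp (2 * (ε - e : ℤ) * η) * exp (2 * e * η) = exp (2 * ε * η) := by
        rw [← exp_add]; push_cast; ring_nf
      rw [← h3, ← sub_mul] at h0
      exact sub_eq_zero.1 ((mul_eq_zero.1 h0).resolve_right (exp_ne_zero _))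
    rw [Metric.mem_closedBall, dist_eq_norm, h2] at hw
    exact hw.not_gt h1
  have hw0 : ∀ w ∈ Metric.closedBall (1 : ℂ) r, w ≠ 0 := by
    rintro w hw rfl
    rw [Metric.mem_closedBall, dist_eq_norm] at hw
    simp at hw; linarith
  refine ⟨fun w => exp ((α + s + 1) * e * η) • (∑ j ∈ Finset.Icc 1 n,
    ∑ ε ∈ (Finset.Icc (-1 : ℤ) 1).erase e,
      ((w * exp (2 * e * η) - exp (2 * ε * η)) ^ j)⁻¹ • ρ ε j X +
    ∑ j ∈ Finset.Icc 1 s.toNat, ((w * exp (2 * e * η)) ^ j)⁻¹ • κ j X), fun x y => ?_,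
    fun w hw => ?_⟩
  · simp only [Matrix.smul_apply, Matrix.add_apply, Matrix.sum_apply, smul_eq_mul]
    refine DifferentiableOn.const_mul (DifferentiableOn.add ?_ ?_) _
    · refine DifferentiableOn.fun_sum fun j _ => DifferentiableOn.fun_sum fun ε hε => ?_
      exact (DifferentiableOn.inv (by fun_prop) fun w hw =>
        pow_ne_zero _ (hne ε hε w hw)).mul_const _
    · refine DifferentiableOn.fun_sum fun j _ => ?_
      exact (DifferentiableOn.inv (by fun_prop) fun w hw =>
        pow_ne_zero _ (mul_ne_zero (hw0 w hw) (exp_ne_zero _))).mul_const _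
  · have hwb := Metric.sphere_subset_closedBall hw
    have hw1 : w - 1 ≠ 0 := by
      intro h
      rw [Metric.mem_sphere, dist_eq_norm, h, norm_zero] at hw
      exact hr.ne hw
    have hlog : exp (2 * (log w / 2)) = w := by
      rw [mul_div_cancel₀ _ two_ne_zero, exp_log (hw0 w hwb)]
    have hself : w * exp (2 * e * η) - exp (2 * e * η) = exp (2 * e * η) * (w - 1) := by ring
    have hdom : ∀ ε ∈ Finset.Icc (-1 : ℤ) 1,
        exp (2 * (log w / 2 + e * η)) ≠ exp (2 * ε * η) := by
      intro ε hε
      rw [exp_shift, hlog, ← sub_ne_zero]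
      by_cases hεe : ε = e
      · rw [hεe, hself]
        exact mul_ne_zero (exp_ne_zero _) hw1
      · exact hne ε (Finset.mem_erase.2 ⟨hεe, hε⟩) w hwb
    have hk := h X hX (log w / 2 + e * η) hdom
    rw [exp_shift, hlog] at hk
    simp only [← Finset.add_sum_erase _ _ he, Finset.sum_add_distrib] at hk
    rw [add_assoc] at hk
    beta_reduce
    rw [kOp_eq η α s, hk, mul_add, exp_add, mul_smul, ← mul_assoc (α + s + 1), smul_add, Finset.smul_sum]
    congr 2
    refine Finset.sum_congr rfl fun j _ => ?_
    rw [hself, smul_smul, smul_smul]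
    congr 1
    rw [mul_pow, mul_inv, ← exp_nat_mul, ← exp_neg, ← mul_assoc, ← exp_add, mul_comm]
    congr 2
    ring

theorem cBar_eq {n : ℕ} {η α u : ℂ} {s : ℤ} {ρ : ℤ → ℕ → Op n →ₗ[ℂ] Op n}
    {κ : ℕ → Op n →ₗ[ℂ] Op n} (h : IsPartialFraction η α s ρ κ) {X : Op n} (hX : HasSpin s X)
    {r : ℝ} (hu : SmallCircle η u r) :
    cBar η α s r u X = exp ((α + s + 1) * u) • ∑ j ∈ Finset.range (n + 1),
      ((exp (2 * u) - 1) ^ j)⁻¹ • cBarCoeff ρ j X := by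
  have h1 := (hasPolarPart_kOp h hX hu (e := 0) (by simp)).contourInt_eq hu
  simp only [Int.cast_zero, zero_mul, mul_zero, add_zero, exp_zero, one_smul] at h1
  rw [cBar, h1]
  congr 1
  exact (sum_withZeroth _ X _).symm

theorem cOp_eq {n : ℕ} {η α u : ℂ} {s : ℤ} {ρ : ℤ → ℕ → Op n →ₗ[ℂ] Op n}
    {κ : ℕ → Op n →ₗ[ℂ] Op n} (h : IsPartialFraction η α s ρ κ) {X : Op n} (hX : HasSpin s X)
    {r : ℝ} (hu : SmallCircle η u r) :
    cOp η α s r u X = exp ((α + s + 1) * u) • ∑ j ∈ Finset.range (n + 1),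
      ((exp (2 * u) - 1) ^ j)⁻¹ • cCoeff η α s ρ j X := by
  have h1 := ((hasPolarPart_kOp h hX hu (e := 1) (by simp)).add
    (hasPolarPart_kOp h hX hu (e := -1) (by simp))).contourInt_eq hu
  simp only [Int.cast_one, Int.cast_neg, one_mul, mul_one, neg_mul, ← sub_eq_add_neg] at h1
  rw [cOp, h1, smul_comm, Finset.smul_sum, cCoeff, sum_withZeroth]
  congr 1
  refine Finset.sum_congr rfl fun j _ => ?_
  rw [smul_comm]
  congr 1
  simp only [LinearMap.smul_apply, LinearMap.add_apply]
  rw [add_comm]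
  ring_nf

theorem fSing_eq {n : ℕ} {η α u : ℂ} {s : ℤ} {ρ : ℤ → ℕ → Op n →ₗ[ℂ] Op n}
    {κ : ℕ → Op n →ₗ[ℂ] Op n} (h : IsPartialFraction η α s ρ κ) {X : Op n} (hX : HasSpin s X)
    {r : ℝ} (hu : SmallCircle η u r) :
    fSing η α s r u X = exp ((α + s + 1) * u) • ∑ j ∈ Finset.range (n + 1),
      ((exp (2 * u) - 1) ^ j)⁻¹ • fCoeff η α s ρ j X := by
  have h1 := ((hasPolarPart_kOp h hX hu (e := 1) (by simp)).neg.add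
    (hasPolarPart_kOp h hX hu (e := -1) (by simp))).contourInt_eq hu
  simp only [Int.cast_one, Int.cast_neg, one_mul, mul_one, neg_mul, ← sub_eq_add_neg] at h1
  rw [fSing, h1, smul_comm, Finset.smul_sum, fCoeff, sum_withZeroth]
  congr 1
  refine Finset.sum_congr rfl fun j _ => ?_
  rw [smul_comm]
  congr 1
  simp only [LinearMap.smul_apply, LinearMap.sub_apply]
  rw [neg_add_eq_sub]
  ring_nf

/-! ### The regular part of `f(ζ,α)` -/

open Filter Topology in
-- For `s < 0` the decomposition has no pole at `w = 0` and its value there is `2κ_0`, while every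
-- term of the numerator carries a power `w^{i-s}` with `i - s ≥ 1`.
theorem kappaCoeff_zero_of_neg {n : ℕ} {η α : ℂ} (hq : ∀ m : ℕ, m ≠ 0 → exp (m * η) ≠ 1) {s : ℤ}
    (hs : s < 0) {ρ : ℤ → ℕ → Op n →ₗ[ℂ] Op n} {κ : ℕ → Op n →ₗ[ℂ] Op n}
    (h : IsPartialFraction η α s ρ κ) {X : Op n} (hX : HasSpin s X) :
    kappaCoeff η ρ κ 0 X = 0 := by
  ext x y
  obtain ⟨c, hc⟩ := kSkal_apply (α := α) hq hX x y
  have hp : ∀ ε : ℤ, (0 : ℂ) - exp (2 * ε * η) ≠ 0 := fun ε => by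
    rw [zero_sub]; exact neg_ne_zero.2 (exp_ne_zero _)
  let L : ℂ → ℂ := fun w => ∑ j ∈ Finset.Icc 1 n, ∑ ε ∈ Finset.Icc (-1 : ℤ) 1,
    ((w - exp (2 * ε * η)) ^ j)⁻¹ * ρ ε j X x y
  let R : ℂ → ℂ := fun w => (∑ i ∈ Finset.range (3 * n + s).toNat, c i * w ^ (i - s).toNat) /
    ∏ ε ∈ Finset.Icc (-1 : ℤ) 1, (w - exp (2 * ε * η)) ^ n
  have hL : ContinuousAt L 0 := by
    refine tendsto_finsetSum _ fun j _ => tendsto_finsetSum _ fun ε _ => ?_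
    exact ContinuousAt.mul (ContinuousAt.inv₀ (by fun_prop) (pow_ne_zero _ (hp ε)))
      continuousAt_const
  have hR : ContinuousAt R 0 :=
    ContinuousAt.div (by fun_prop) (by fun_prop)
      (Finset.prod_ne_zero_iff.2 fun ε _ => pow_ne_zero _ (hp ε))
  have hLR : L =ᶠ[𝓝[≠] 0] R := by
    have h1 : ∀ᶠ w in 𝓝[≠] (0 : ℂ), ∀ ε ∈ Finset.Icc (-1 : ℤ) 1, w ≠ exp (2 * ε * η) := by
      refine (Finset.eventually_all _).2 fun ε _ => ?_
      exact (continuousAt_id.eventually_ne (exp_ne_zero (2 * ε * η)).symm).filter_mono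
        nhdsWithin_le_nhds
    filter_upwards [h1, self_mem_nhdsWithin] with w hw hw0
    have hlog : exp (2 * (log w / 2)) = w := by
      rw [mul_div_cancel₀ _ two_ne_zero, exp_log hw0]
    have hdom : ∀ ε ∈ Finset.Icc (-1 : ℤ) 1, exp (2 * (log w / 2)) ≠ exp (2 * ε * η) := by
      rwa [hlog]
    have h2 := congrFun (congrFun (h X hX _ hdom) x) y
    rw [hc _ hdom, Int.toNat_of_nonpos hs.le] at h2
    simp only [hlog, Finset.Icc_eq_empty_of_lt zero_lt_one, Finset.sum_empty, add_zero,
      Matrix.sum_apply, Matrix.smul_apply, smul_eq_mul] at h2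
    simp only [L, R]
    rw [← h2]
    congr 1
    refine Finset.sum_congr rfl fun i _ => ?_
    congr 1
    have h3 : (((i - s).toNat : ℕ) : ℂ) = i - s := by
      have : (((i - s).toNat : ℕ) : ℤ) = i - s := by omega
      exact_mod_cast this
    rw [← hlog, ← exp_nat_mul, h3, hlog]
    ring_nf
  have h0 : L 0 = R 0 := tendsto_nhds_unique
    ((hL.tendsto.mono_left nhdsWithin_le_nhds).congr' hLR) (hR.tendsto.mono_left nhdsWithin_le_nhds)
  have hR0 : R 0 = 0 := by
    simp only [R]
    rw [Finset.sum_eq_zero fun i _ => by rw [zero_pow (by omega), mul_zero], zero_div]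
  rw [hR0] at h0
  simp only [kappaCoeff, if_pos, LinearMap.smul_apply, LinearMap.sum_apply, Matrix.smul_apply,
    Matrix.sum_apply, smul_eq_mul, Matrix.zero_apply, mul_eq_zero]
  right
  rw [← h0]
  refine Finset.sum_congr rfl fun j _ => ?_
  rw [Finset.mul_sum]
  refine Finset.sum_congr rfl fun ε _ => ?_
  rw [zero_sub, neg_pow (exp _), mul_inv, ← exp_nat_mul, ← exp_neg, ← inv_pow, inv_neg_one, ← mul_assoc]
  congr 3
  ring

section Regular

variable {n : ℕ} {η α : ℂ} {s : ℤ}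

/-- This is the eigenvalue of `g ↦ g(qζ) - g(q⁻¹ζ)` on `ζ^{α+s+1+2m}`. Its vanishing would give
`q^{2(α+s+1+2m)} = 1`. -/
theorem regular_denom_ne_zero (hα : ∀ m : ℤ, exp (2 * (α + m) * η) ≠ 1) (s m : ℤ) :
    exp ((α + s + 1 + 2 * m) * η) - exp (-(α + s + 1 + 2 * m) * η) ≠ 0 := by
  intro h
  apply hα (s + 1 + 2 * m)
  have h1 : exp (2 * (α + (s + 1 + 2 * m : ℤ)) * η) =
      exp ((α + s + 1 + 2 * m) * η) * exp ((α + s + 1 + 2 * m) * η) := by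
    rw [← exp_add]; push_cast; ring_nf
  rw [h1]
  nth_rewrite 2 [sub_eq_zero.1 h]
  rw [← exp_add, neg_mul, add_neg_cancel, exp_zero]

theorem SmallCircle.mem_kDomain {u : ℂ} {r : ℝ} (h0 : SmallCircle η u r)
    (h1 : SmallCircle η (u + η) r) (h2 : SmallCircle η (u - η) r) : u ∈ kDomain η := by
  have key : ∀ u : ℂ, SmallCircle η u r → exp (2 * u) ≠ 1 := by
    rintro u ⟨hr, -, hu, -⟩ h
    rw [h, sub_self, norm_zero] at hu
    exact hr.not_gt hu
  intro ε hε h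
  have h3 : ∀ v : ℂ, exp (2 * u) = exp (2 * v) → exp (2 * (u - v)) = 1 := fun v h => by
    rw [mul_sub, exp_sub, h, div_self (exp_ne_zero _)]
  rw [mul_assoc] at h
  have h4 := h3 _ h
  rw [Finset.mem_Icc] at hε
  obtain rfl | rfl | rfl : ε = -1 ∨ ε = 0 ∨ ε = 1 := by omega
  · exact key _ h1 (by simpa using h4)
  · exact key _ h0 (by simpa using h4)
  · exact key _ h2 (by simpa using h4)

open Filter Topology in
-- The functional equation is postulated only for circles that suit `ζ`, `qζ` and `q⁻¹ζ` at once.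
-- Uniqueness needs one at each point used.
theorem exists_smallCircle (hq : ∀ m : ℕ, m ≠ 0 → exp (m * η) ≠ 1) {u : ℂ} (hu : u ∈ kDomain η) :
    ∃ r, SmallCircle η u r ∧ SmallCircle η (u + η) r ∧ SmallCircle η (u - η) r := by
  have hlt : ∀ a : ℂ, a ≠ 1 → ∀ᶠ r in 𝓝[>] (0 : ℝ), r < ‖a - 1‖ := fun a ha =>
    (eventually_lt_nhds (norm_pos_iff.2 (sub_ne_zero.2 ha))).filter_mono nhdsWithin_le_nhds
  have hm : ∀ᶠ r in 𝓝[>] (0 : ℝ), ∀ m ∈ Finset.Icc (-2 : ℤ) 2, m ≠ 0 →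
      r < ‖exp (2 * m * η) - 1‖ := by
    refine (Finset.eventually_all _).2 fun m _ => ?_
    by_cases hm0 : m = 0
    · simp [hm0]
    · filter_upwards [hlt (exp (2 * m * η)) fun h => hm0
        (exp_mul_intCast_injective hq (by simpa using h))] with r hr _ using hr
  have h1 : ∀ᶠ r in 𝓝[>] (0 : ℝ), r < 1 :=
    (eventually_lt_nhds zero_lt_one).filter_mono nhdsWithin_le_nhds
  have hu0 : exp (2 * u) ≠ 1 := (kDomain_subset hu).1
  have hu1 : exp (2 * (u + η)) ≠ 1 := fun h => hu (-1) (by simp) (by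
    rw [mul_add, exp_add] at h
    rw [eq_inv_of_mul_eq_one_left h, ← exp_neg]; push_cast; ring_nf)
  have hu2 : exp (2 * (u - η)) ≠ 1 := fun h => hu 1 (by simp) (by
    rw [mul_sub, exp_sub, div_eq_one_iff_eq (exp_ne_zero _)] at h
    simpa using h)
  obtain ⟨r, h⟩ := (hm.and (h1.and ((hlt _ hu0).and ((hlt _ hu1).and
    ((hlt _ hu2).and self_mem_nhdsWithin))))).exists
  obtain ⟨hm, h1, hu0, hu1, hu2, hr⟩ := h
  exact ⟨r, ⟨hr, h1, hu0, hm⟩, ⟨hr, h1, hu1, hm⟩, ⟨hr, h1, hu2, hm⟩⟩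

/-- The explicit form of `f^reg(ζ,α) X`. -/
def regularPart (η α : ℂ) (s : ℤ) (ρ : ℤ → ℕ → Op n →ₗ[ℂ] Op n) (κ : ℕ → Op n →ₗ[ℂ] Op n)
    (X : Op n) (u : ℂ) : Op n :=
  exp ((α + s + 1) * u) • ∑ j ∈ Finset.range (s + 1).toNat,
    (exp (-2 * j * u) / (exp ((α + s + 1 - 2 * j) * η) - exp ((2 * j - α - s - 1) * η))) •
      kappaCoeff η ρ κ j X

theorem regularPart_sub (hα : ∀ m : ℤ, exp (2 * (α + m) * η) ≠ 1)
    (ρ : ℤ → ℕ → Op n →ₗ[ℂ] Op n) (κ : ℕ → Op n →ₗ[ℂ] Op n) (X : Op n) (u : ℂ) :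
    regularPart η α s ρ κ X (u + η) - regularPart η α s ρ κ X (u - η) =
      exp ((α + s + 1) * u) • ∑ j ∈ Finset.range (s + 1).toNat,
        (exp (2 * u) ^ j)⁻¹ • kappaCoeff η ρ κ j X := by
  simp only [regularPart, Finset.smul_sum, smul_smul, ← Finset.sum_sub_distrib, ← sub_smul]
  refine Finset.sum_congr rfl fun j _ => ?_
  congr 1
  have hd := regular_denom_ne_zero hα s (-j)
  have e1 : exp ((α + s + 1 + 2 * (-j : ℤ)) * η) = exp ((α + s + 1 - 2 * j) * η) := by
    push_cast; ring_nf
  have e2 : exp (-(α + s + 1 + 2 * (-j : ℤ)) * η) = exp ((2 * j - α - s - 1) * η) := by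
    push_cast; ring_nf
  rw [e1, e2] at hd
  rw [mul_div_assoc', mul_div_assoc', ← sub_div, div_eq_iff hd, ← exp_nat_mul, ← exp_neg,
    ← exp_add, ← exp_add, ← exp_add, mul_sub (exp _), ← exp_add, ← exp_add]
  congr 2 <;> ring

/-- For `s < 0` the left side is empty, so the identity then rests on `κ_0 X = 0`. -/
theorem sum_kappaCoeff (hq : ∀ m : ℕ, m ≠ 0 → exp (m * η) ≠ 1)
    {ρ : ℤ → ℕ → Op n →ₗ[ℂ] Op n} {κ : ℕ → Op n →ₗ[ℂ] Op n}
    (h : IsPartialFraction η α s ρ κ) {X : Op n} (hX : HasSpin s X) (w : ℂ) :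
    ∑ j ∈ Finset.range (s + 1).toNat, (w ^ j)⁻¹ • kappaCoeff η ρ κ j X =
      kappaCoeff η ρ κ 0 X + ∑ j ∈ Finset.Icc 1 s.toNat, (w ^ j)⁻¹ • κ j X := by
  by_cases hs : s < 0
  · rw [kappaCoeff_zero_of_neg hq hs h hX, Int.toNat_of_nonpos (by omega),
      Int.toNat_of_nonpos hs.le]
    simp
  · rw [show (s + 1).toNat = s.toNat + 1 by omega, Finset.range_eq_Ico,
      Finset.sum_eq_sum_Ico_succ_bot (Nat.succ_pos _)]
    have h : Finset.Ico (0 + 1) (s.toNat + 1) = Finset.Icc 1 s.toNat := by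
      ext; simp only [Finset.mem_Ico, Finset.mem_Icc]; omega
    rw [h]
    congr 1
    · simp
    · refine Finset.sum_congr rfl fun j hj => ?_
      have := (Finset.mem_Icc.1 hj).1
      rw [kappaCoeff, if_neg (by omega)]

/-- As `c_j + f_j` contains only `ρ^{(-)}` and `c_j - f_j` only `ρ^{(+)}`, the terms at `qζ` give
the poles at `ζ² = q^{-2}` and those at `q⁻¹ζ` the poles at `q²`. The zeroth coefficients sum to
`-κ_0`, cancelled by the difference of `regularPart`. -/
theorem isRegularPart_regularPart (hq : ∀ m : ℕ, m ≠ 0 → exp (m * η) ≠ 1)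
    (hα : ∀ m : ℤ, exp (2 * (α + m) * η) ≠ 1)
    {ρ : ℤ → ℕ → Op n →ₗ[ℂ] Op n} {κ : ℕ → Op n →ₗ[ℂ] Op n}
    (h : IsPartialFraction η α s ρ κ) {X : Op n} (hX : HasSpin s X) :
    IsRegularPart η α s X (regularPart η α s ρ κ X) := by
  refine ⟨⟨∑ j ∈ Finset.range (s + 1).toNat, Finsupp.single (-j : ℤ)
    ((1 / (exp ((α + s + 1 - 2 * j) * η) - exp ((2 * j - α - s - 1) * η))) •
      kappaCoeff η ρ κ j X), fun u => ?_⟩, fun u r h0 h1 h2 => ?_⟩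
  · rw [regularPart, ← Finsupp.sum_finsetSum_index (by simp) (by simp)]
    congr 1
    refine Finset.sum_congr rfl fun j _ => ?_
    rw [Finsupp.sum_single_index (by simp), smul_smul]
    congr 1
    rw [mul_one_div]
    push_cast
    ring_nf
  · have hu := h0.mem_kDomain h1 h2
    have hreg := regularPart_sub (s := s) hα ρ κ X u
    rw [sum_kappaCoeff hq h hX] at hreg
    have hI : Finset.Icc (-1 : ℤ) 1 = {-1, 0, 1} := by decide
    have hp : exp (2 * (u + η)) - 1 = exp (2 * η) * (exp (2 * u) - exp (-2 * η)) := by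
      rw [mul_sub (exp _), ← exp_add, ← exp_add, mul_add, add_comm]; simp
    have hm : exp (2 * (u - η)) - 1 = exp (-2 * η) * (exp (2 * u) - exp (2 * η)) := by
      rw [mul_sub (exp _), ← exp_add, ← exp_add]; ring_nf; simp; ring
    have hcalc : kOp η α u X = cBar η α s r u X + cOp η α s r (u + η) X + cOp η α s r (u - η) X
        + fSing η α s r (u + η) X - fSing η α s r (u - η) X +
        (regularPart η α s ρ κ X (u + η) - regularPart η α s ρ κ X (u - η)) := by
      have ep : exp ((α + s + 1) * (u + η)) = exp ((α + s + 1) * u) * exp ((α + s + 1) * η) := by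
        rw [← exp_add]; ring_nf
      have em : exp ((α + s + 1) * (u - η)) = exp ((α + s + 1) * u) * exp (-(α + s + 1) * η) := by
        rw [← exp_add]; ring_nf
      rw [hreg, cBar_eq h hX h0, cOp_eq h hX h1, cOp_eq h hX h2, fSing_eq h hX h1, fSing_eq h hX h2,
        kOp_eq η α s, h X hX u hu, ep, em]
      simp only [mul_smul, ← smul_add, ← smul_sub]
      congr 1
      rw [← add_assoc]
      congr 1
      rw [cBarCoeff, cCoeff, fCoeff, sum_withZeroth, sum_withZeroth, sum_withZeroth,
        sum_withZeroth, sum_withZeroth, kappaCoeff, if_pos rfl]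
      simp only [LinearMap.smul_apply, LinearMap.sum_apply, Finset.smul_sum,
        ← Finset.sum_add_distrib, ← Finset.sum_sub_distrib]
      refine Finset.sum_congr rfl fun j hj => ?_
      obtain ⟨i, rfl⟩ : ∃ i, j = i + 1 := ⟨j - 1, by have := (Finset.mem_Icc.1 hj).1; omega⟩
      rw [hI, Finset.sum_insert (by decide), Finset.sum_insert (by decide), Finset.sum_singleton,
        Finset.sum_insert (by decide), Finset.sum_insert (by decide), Finset.sum_singleton]
      have hb : exp ((α + s + 1) * η) * exp ((2 * (i + 1 : ℕ) - α - s - 1) * η) =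
          exp (2 * η) ^ (i + 1) := by
        rw [← exp_add, ← exp_nat_mul]; ring_nf
      have hc : exp (-(α + s + 1) * η) * exp ((α + s + 1 - 2 * (i + 1 : ℕ)) * η) =
          exp (-2 * η) ^ (i + 1) := by
        rw [← exp_add, ← exp_nat_mul]; ring_nf
      have e1 : exp (-2 * ((-1 : ℤ) : ℂ) * (i + 1 : ℕ) * η) = exp (2 * η) ^ (i + 1) := by
        rw [← exp_nat_mul]; push_cast; ring_nf
      have e2 : exp (-2 * ((1 : ℤ) : ℂ) * (i + 1 : ℕ) * η) = exp (-2 * η) ^ (i + 1) := by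
        rw [← exp_nat_mul]; push_cast; ring_nf
      have e3 : exp (-2 * ((0 : ℤ) : ℂ) * (i + 1 : ℕ) * η) = 1 := by simp
      have e4 : exp (2 * ((-1 : ℤ) : ℂ) * η) = exp (-2 * η) := by push_cast; ring_nf
      have e5 : exp (2 * ((0 : ℤ) : ℂ) * η) = 1 := by simp
      have e6 : exp (2 * ((1 : ℤ) : ℂ) * η) = exp (2 * η) := by push_cast; ring_nf
      rw [hp, hm, e1, e2, e3, e4, e5, e6, mul_pow, mul_pow, mul_inv, mul_inv, ← hb, ← hc,
        Nat.add_sub_cancel, pow_succ (-1 : ℂ)]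
      simp only [LinearMap.smul_apply, LinearMap.add_apply, LinearMap.sub_apply]
      generalize ((exp (2 * u) - exp (-2 * η)) ^ (i + 1))⁻¹ = p
      generalize ((exp (2 * u) - exp (2 * η)) ^ (i + 1))⁻¹ = m
      match_scalars <;> field_simp <;> ring
    rw [hcalc]
    abel

/-! ### Uniqueness of the regular part -/

theorem exists_mem_kDomain (η : ℂ) : ∃ t : ℂ, ∀ k : ℕ, t + k ∈ kDomain η := by
  -- From here on `|ζ²|` exceeds `1` and `|q^{±2}|`, so no pole is met.
  refine ⟨(|η.re| + 1 : ℝ), fun k ε hε h => ?_⟩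
  have h1 := congrArg (fun z => Real.log ‖z‖) h
  simp only [norm_exp, Real.log_exp] at h1
  simp at h1
  rw [Finset.mem_Icc] at hε
  have hk : (0 : ℝ) ≤ k := Nat.cast_nonneg k
  have h2 := le_abs_self η.re
  have h3 := neg_abs_le η.re
  have h4 := abs_nonneg η.re
  obtain rfl | rfl | rfl : ε = -1 ∨ ε = 0 ∨ ε = 1 := by omega
  all_goals push_cast at h1; linarith

/-- Along the progression the monomials are, up to constants, the characters `k ↦ e^{2mk}` of `ℕ`,
which are distinct by their moduli and hence independent by Dedekind. -/
theorem laurent_eq_zero {t : ℂ} (S : Finset ℤ) (b : ℤ → ℂ)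
    (h : ∀ k : ℕ, ∑ m ∈ S, exp (2 * m * (t + k)) * b m = 0) : ∀ m ∈ S, b m = 0 := by
  have hinj : Function.Injective (fun m : ℤ => powersHom ℂ (exp (2 * m))) := by
    intro m m' h
    have h1 : exp (2 * m) = exp (2 * m') := by
      have := DFunLike.congr_fun h (Multiplicative.ofAdd 1)
      simpa [powersHom_apply] using this
    have h2 := congrArg (fun z => Real.log ‖z‖) h1
    simp only [norm_exp, Real.log_exp] at h2
    simpa using h2
  have hli := (linearIndependent_monoidHom (Multiplicative ℕ) ℂ).comp _ hinj
  intro m hm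
  have h1 := linearIndependent_iff'.1 hli S (fun m => exp (2 * m * t) * b m) (by
    funext k
    have h2 := h k.toAdd
    rw [Finset.sum_apply, Pi.zero_apply, ← h2]
    refine Finset.sum_congr rfl fun m _ => ?_
    simp only [Function.comp_apply, Pi.smul_apply, powersHom_apply, smul_eq_mul]
    rw [mul_add, exp_add, ← exp_nat_mul, mul_comm (2 * (m : ℂ)) (k.toAdd : ℂ)]
    ring) m hm
  exact (mul_eq_zero.1 h1).resolve_left (exp_ne_zero _)

theorem IsRegularPart.unique (hq : ∀ m : ℕ, m ≠ 0 → exp (m * η) ≠ 1)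
    (hα : ∀ m : ℤ, exp (2 * (α + m) * η) ≠ 1) {X : Op n} {g g' : ℂ → Op n}
    (h : IsRegularPart η α s X g) (h' : IsRegularPart η α s X g') : g = g' := by
  obtain ⟨⟨G, hG⟩, h⟩ := h
  obtain ⟨⟨G', hG'⟩, h'⟩ := h'
  suffices hGG : G = G' by funext u; rw [hG, hG', hGG]
  obtain ⟨t, ht⟩ := exists_mem_kDomain η
  have hsum : ∀ (u : ℂ), G.sum (fun m A => exp (2 * m * u) • A) -
      G'.sum (fun m A => exp (2 * m * u) • A) =
      ∑ m ∈ G.support ∪ G'.support, exp (2 * m * u) • (G m - G' m) := by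
    intro u
    rw [Finsupp.sum_of_support_subset G Finset.subset_union_left _ (by simp),
      Finsupp.sum_of_support_subset G' Finset.subset_union_right _ (by simp),
      ← Finset.sum_sub_distrib]
    simp only [smul_sub]
  -- The difference of two solutions is annihilated by the difference operator, which is diagonal on
  -- the Laurent coefficients.
  have key : ∀ x y, ∀ m ∈ G.support ∪ G'.support,
      (exp ((α + s + 1 + 2 * m) * η) - exp (-(α + s + 1 + 2 * m) * η)) * (G m - G' m) x y = 0 := by
    intro x y
    refine laurent_eq_zero (t := t) _ _ fun k => ?_
    obtain ⟨r, h0, h1, h2⟩ := exists_smallCircle hq (ht k)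
    have e := (h _ r h0 h1 h2).symm.trans (h' _ r h0 h1 h2)
    have e' : (g (t + k + η) - g' (t + k + η)) - (g (t + k - η) - g' (t + k - η)) = 0 := by
      rw [← sub_eq_zero] at e
      rw [← e]
      abel
    rw [hG, hG, hG', hG', ← smul_sub, ← smul_sub, hsum, hsum] at e'
    have e2 := congrFun (congrFun e' x) y
    simp only [Matrix.sub_apply, Matrix.smul_apply, Matrix.sum_apply, smul_eq_mul,
      Finset.mul_sum, ← Finset.sum_sub_distrib, Matrix.zero_apply] at e2
    have e3 : exp ((α + s + 1) * (t + k)) * ∑ m ∈ G.support ∪ G'.support,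
        exp (2 * m * (t + k)) * ((exp ((α + s + 1 + 2 * m) * η) -
          exp (-(α + s + 1 + 2 * m) * η)) * (G m - G' m) x y) = 0 := by
      rw [← e2, Finset.mul_sum]
      refine Finset.sum_congr rfl fun m _ => ?_
      rw [Matrix.sub_apply, ← mul_assoc, ← mul_assoc, ← mul_assoc, ← mul_assoc, ← exp_add, ← sub_mul,
        ← exp_add, ← exp_add, mul_sub (exp _), ← exp_add, ← exp_add]
      congr 3 <;> ring
    exact (mul_eq_zero.1 e3).resolve_left (exp_ne_zero _)
  ext m x y
  by_cases hm : m ∈ G.support ∪ G'.support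
  · have := (mul_eq_zero.1 (key x y m hm)).resolve_left (regular_denom_ne_zero hα s m)
    exact sub_eq_zero.1 this
  · rw [Finset.mem_union, not_or, Finsupp.notMem_support_iff, Finsupp.notMem_support_iff] at hm
    rw [hm.1, hm.2]

theorem fReg_eq (hq : ∀ m : ℕ, m ≠ 0 → exp (m * η) ≠ 1)
    (hα : ∀ m : ℤ, exp (2 * (α + m) * η) ≠ 1) {X : Op n} {g : ℂ → Op n}
    (h : IsRegularPart η α s X g) (u : ℂ) : fReg η α s u X = g u := by
  have hex : ∃ g, IsRegularPart η α s X g := ⟨g, h⟩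
  rw [fReg, dif_pos hex, hex.choose_spec.unique hq hα h]

end Regular

end XXZ

end

theorem mainTheorem4 (η α : ℂ)
    (hq : ∀ m : ℕ, m ≠ 0 → Complex.exp (m * η) ≠ 1)
    (hα : ∀ m : ℤ, Complex.exp (2 * (α + m) * η) ≠ 1)
    (n : ℕ) (s : ℤ) :
    (∃ (ρ : ℤ → ℕ → XXZ.Op n →ₗ[ℂ] XXZ.Op n) (κ : ℕ → XXZ.Op n →ₗ[ℂ] XXZ.Op n),
      XXZ.IsPartialFraction η α s ρ κ) ∧
    ∀ (ρ : ℤ → ℕ → XXZ.Op n →ₗ[ℂ] XXZ.Op n) (κ : ℕ → XXZ.Op n →ₗ[ℂ] XXZ.Op n),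
      XXZ.IsPartialFraction η α s ρ κ →
      ∀ X : XXZ.Op n, XXZ.HasSpin s X →
        (∃! g : ℂ → XXZ.Op n, XXZ.IsRegularPart η α s X g) ∧
        ∀ (u : ℂ) (r : ℝ), XXZ.SmallCircle η u r →
          XXZ.cBar η α s r u X = Complex.exp ((α + s + 1) * u) •
            ∑ j ∈ Finset.range (n + 1),
              ((Complex.exp (2 * u) - 1) ^ j)⁻¹ • XXZ.cBarCoeff ρ j X ∧
          XXZ.cOp η α s r u X = Complex.exp ((α + s + 1) * u) •
            ∑ j ∈ Finset.range (n + 1),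
              ((Complex.exp (2 * u) - 1) ^ j)⁻¹ • XXZ.cCoeff η α s ρ j X ∧
          XXZ.fOp η α s r u X = Complex.exp ((α + s + 1) * u) •
            (∑ j ∈ Finset.range (n + 1),
                ((Complex.exp (2 * u) - 1) ^ j)⁻¹ • XXZ.fCoeff η α s ρ j X
              + ∑ j ∈ Finset.range (s + 1).toNat,
                (Complex.exp (-2 * j * u) / (Complex.exp ((α + s + 1 - 2 * j) * η)
                    - Complex.exp ((2 * j - α - s - 1) * η))) •
                  XXZ.kappaCoeff η ρ κ j X) := by
  refine ⟨XXZ.exists_isPartialFraction hq s, fun ρ κ h X hX => ?_⟩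
  have hreg := XXZ.isRegularPart_regularPart hq hα h hX
  refine ⟨⟨_, hreg, fun g hg => hg.unique hq hα hreg⟩, fun u r hu =>
    ⟨XXZ.cBar_eq h hX hu, XXZ.cOp_eq h hX hu, ?_⟩⟩
  rw [XXZ.fOp, XXZ.fSing_eq h hX hu, XXZ.fReg_eq hq hα hreg, XXZ.regularPart, smul_add]
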